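/- All algebras are Heyting algebras, in the signature $\{\wedge,\vee,\to,\neg\}$. Let $\mathbf{Z}$ be the Rieger–Nishimura ladder (the free Heyting algebra on one generator), $\mathbf{Z}_2$ the two-element Boolean algebra and, for $m\ge 1$, $\mathbf{Z}_m$ the one-generated algebra with exactly $m$ elements. For algebras $\mathbf{A},\mathbf{B}$ let $\mathbf{A}+\mathbf{B}$ be the concatenation, obtained by putting $\mathbf{B}$ on top of $\mathbf{A}$ and gluing the top element of $\mathbf{A}$ to the bottom element of $\mathbf{B}$; $\mathbf{Z}\times\mathbf{Z}_2+\mathbf{B}$ means $(\mathbf{Z}\times\mathbf{Z}_2)+\mathbf{B}$. An algebra $\mathbf{A}$ is finitely presentable over a variety $\mathcal{V}$ if there are a propositional formula $A(p_1,\dots,p_n)$ and elements $a_1,\dots,a_n$ that generate $\mathbf{A}$ such that $A(a_1,\dots,a_n)=1$ and, for every formula $B(p_1,\dots,p_n)$ with $B(a_1,\dots,a_n)=1$, the formula $A\to B$ is valid in every algebra of $\mathcal{V}$. Let $\mathcal{V}$ be the variety generated by $\mathbf{Z}\times\mathbf{Z}_2+\mathbf{Z}$. Then $\mathcal{V}$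 contains infinitely many pairwise non-isomorphic infinite subdirectly irreducible algebras that are finitely presentable over $\mathcal{V}$. Examples are the algebras $\mathbf{Z}\times\mathbf{Z}_2+\mathbf{Z}_{2n+1}$, $n=1,2,\dots$: each of them is infinite, subdirectly irreducible, a member of $\mathcal{V}$ and finitely presentable over $\mathcal{V}$, and they are pairwise non-isomorphic. -/

import Mathlib

namespace HeytingVarieties

universe u

/-- Propositional formulas in the signature `∧, ∨, →, ¬`, with variables from `α`. -/
inductive PropFormula (α : Type) : Type
  | var : α → PropFormula α
  | and : PropFormula α → PropFormula α → PropFormula α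
  | or : PropFormula α → PropFormula α → PropFormula α
  | imp : PropFormula α → PropFormula α → PropFormula α
  | neg : PropFormula α → PropFormula α

/-- The value of a formula in a Heyting algebra under a valuation `v` of the variables. -/
def PropFormula.eval {α : Type} {H : Type u} [HeytingAlgebra H] (v : α → H) : PropFormula α → H
  | .var p => v p
  | .and A B => A.eval v ⊓ B.eval v
  | .or A B => A.eval v ⊔ B.eval v
  | .imp A B => A.eval v ⇨ B.eval v
  | .neg A => (A.eval v)ᶜ

/-- A set of elements closed under the operations `∧, ∨, →, ¬`. -/
structure IsSubalgebra {H : Type u} [HeytingAlgebra H] (S : Set H) : Prop where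
  inf_mem : ∀ x ∈ S, ∀ y ∈ S, x ⊓ y ∈ S
  sup_mem : ∀ x ∈ S, ∀ y ∈ S, x ⊔ y ∈ S
  himp_mem : ∀ x ∈ S, ∀ y ∈ S, x ⇨ y ∈ S
  compl_mem : ∀ x ∈ S, xᶜ ∈ S

/-- The set `G` generates the algebra `H`: the only subalgebra containing `G` is `H` itself. -/
def Generates {H : Type u} [HeytingAlgebra H] (G : Set H) : Prop :=
  ∀ S : Set H, IsSubalgebra S → G ⊆ S → S = Set.univ

/-- `H` is generated by a single element. -/
def OneGenerated (H : Type u) [HeytingAlgebra H] : Prop :=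
  ∃ g : H, Generates ({g} : Set H)

/-- A variety of Heyting algebras: a class defined, within all Heyting algebras, by a set of
identities `s ≈ t`. -/
def IsVariety (K : Set HeytAlg.{u}) : Prop :=
  ∃ E : Set (PropFormula ℕ × PropFormula ℕ),
    K = {B : HeytAlg.{u} | ∀ e ∈ E, ∀ v : ℕ → B, e.1.eval v = e.2.eval v}

/-- The variety generated by an algebra: the intersection of all varieties containing it. -/
def generatedVariety (A : HeytAlg.{u}) : Set HeytAlg.{u} :=
  {B | ∀ K : Set HeytAlg.{u}, IsVariety K → A ∈ K → B ∈ K}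

/-- `⊢_V A`: the formula `A` is valid in every algebra of the class `V`. -/
def ValidIn {α : Type} (V : Set HeytAlg.{u}) (A : PropFormula α) : Prop :=
  ∀ B ∈ V, ∀ v : α → B, A.eval v = ⊤

/-- The formula `A(p₁,…,pₙ)` and the valuation `a` define the algebra `H` over `V`. -/
structure Defines (V : Set HeytAlg.{u}) {H : Type u} [HeytingAlgebra H] {n : ℕ}
    (A : PropFormula (Fin n)) (a : Fin n → H) : Prop where
  generates : Generates (Set.range a)
  eval_eq_top : A.eval a = ⊤
  valid_of_eval_eq_top : ∀ B : PropFormula (Fin n), B.eval a = ⊤ → ValidIn V (A.imp B)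

/-- `H` is finitely presentable over `V`. -/
def FinitelyPresentableOver (V : Set HeytAlg.{u}) (H : Type u) [HeytingAlgebra H] : Prop :=
  ∃ (n : ℕ) (A : PropFormula (Fin n)) (a : Fin n → H), Defines V A a

/-- `H` is subdirectly irreducible: in every representation of `H` as a subdirect product, one
of the projections is an isomorphism. (The empty product is allowed, so the one-element algebra
is not subdirectly irreducible.) -/
def SubdirectlyIrreducible (H : Type u) [HeytingAlgebra H] : Prop :=
  ∀ (I : Type u) (B : I → HeytAlg.{u}) (f : ∀ i, HeytingHom H (B i)),
    (∀ i, Function.Surjective (f i)) → Function.Injective (fun (x : H) (i : I) => f i x) →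
      ∃ i, Function.Bijective (f i)

/-- `FPSI(V)`: the subdirectly irreducible algebras from `V` that are finitely presentable
over `V`. -/
def FPSI (V : Set HeytAlg.{u}) : Set HeytAlg.{u} :=
  {A | A ∈ V ∧ SubdirectlyIrreducible A ∧ FinitelyPresentableOver V A}

/-- The concatenation `A + B`: the algebra `B` is put on top of `A`, and the top of `A` is glued
to the bottom of `B`. An element `a` of `A` is the pair `(a, ⊥)`, an element `b` of `B` is the
pair `(⊤, b)`, and `(⊤, ⊥)` is the glued element; in this form the order is componentwise. -/
@[ext]
structure Concat (A B : Type u) [HeytingAlgebra A] [HeytingAlgebra B] : Type u where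
  fst : A
  snd : B
  glue : fst = ⊤ ∨ snd = ⊥

namespace Concat

variable {A B : Type u} [HeytingAlgebra A] [HeytingAlgebra B]

instance : PartialOrder (Concat A B) where
  le x y := x.fst ≤ y.fst ∧ x.snd ≤ y.snd
  le_refl _ := ⟨le_rfl, le_rfl⟩
  le_trans _ _ _ h k := ⟨h.1.trans k.1, h.2.trans k.2⟩
  le_antisymm _ _ h k := Concat.ext (h.1.antisymm k.1) (h.2.antisymm k.2)

theorem le_def (x y : Concat A B) : x ≤ y ↔ x.fst ≤ y.fst ∧ x.snd ≤ y.snd := Iff.rfl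

open Classical in
noncomputable instance : HeytingAlgebra (Concat A B) where
  sup x y := ⟨x.fst ⊔ y.fst, x.snd ⊔ y.snd, by
    rcases x.glue with h | h <;> rcases y.glue with k | k <;> simp [h, k]⟩
  inf x y := ⟨x.fst ⊓ y.fst, x.snd ⊓ y.snd, by
    rcases x.glue with h | h <;> rcases y.glue with k | k <;> simp [h, k]⟩
  top := ⟨⊤, ⊤, Or.inl rfl⟩
  bot := ⟨⊥, ⊥, Or.inr rfl⟩
  himp x y := ⟨x.fst ⇨ y.fst, if x.fst ≤ y.fst then x.snd ⇨ y.snd else ⊥, by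
    by_cases h : x.fst ≤ y.fst <;> simp [h]⟩
  compl x := ⟨x.fst ⇨ ⊥, if x.fst ≤ ⊥ then x.snd ⇨ ⊥ else ⊥, by
    by_cases h : x.fst ≤ (⊥ : A)
    · exact Or.inl (himp_eq_top_iff.2 h)
    · exact Or.inr (if_neg h)⟩
  le_sup_left _ _ := ⟨le_sup_left, le_sup_left⟩
  le_sup_right _ _ := ⟨le_sup_right, le_sup_right⟩
  sup_le _ _ _ h k := ⟨sup_le h.1 k.1, sup_le h.2 k.2⟩
  inf_le_left _ _ := ⟨inf_le_left, inf_le_left⟩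
  inf_le_right _ _ := ⟨inf_le_right, inf_le_right⟩
  le_inf _ _ _ h k := ⟨le_inf h.1 k.1, le_inf h.2 k.2⟩
  le_top _ := ⟨le_top, le_top⟩
  bot_le _ := ⟨bot_le, bot_le⟩
  himp_bot _ := rfl
  le_himp_iff x y z := by
    by_cases h : y.fst ≤ z.fst
    · have h1 : x.fst ⊓ y.fst ≤ z.fst := inf_le_right.trans h
      change x.fst ≤ _ ∧ x.snd ≤ _ ↔ x.fst ⊓ y.fst ≤ z.fst ∧ x.snd ⊓ y.snd ≤ z.snd
      simp [h, le_himp_iff, h1]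
    · have hz : z.snd = ⊥ := z.glue.resolve_left fun e => h (e ▸ le_top)
      change x.fst ≤ _ ∧ x.snd ≤ _ ↔ x.fst ⊓ y.fst ≤ z.fst ∧ x.snd ⊓ y.snd ≤ z.snd
      simp only [h, if_false, le_himp_iff, hz, le_bot_iff]
      refine and_congr_right fun h1 => ⟨fun h2 => by simp [h2], fun _ => ?_⟩
      refine x.glue.resolve_left fun e => h ?_
      simpa [e] using h1

end Concat

/-- Two formulas in one variable are identified when they take equal values in all Heyting
algebras. -/
def ladderSetoid : Setoid (PropFormula Unit) where
  r A B := ∀ (H : HeytAlg.{0}) (v : Unit → H), A.eval v = B.eval v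
  iseqv := ⟨fun _ _ _ => rfl, fun h H v => (h H v).symm, fun h k H v => (h H v).trans (k H v)⟩

/-- The Rieger–Nishimura ladder `Z`: the free Heyting algebra on one generator, that is, the
formulas in one variable modulo the identities valid in all Heyting algebras. -/
def Ladder : Type := Quotient ladderSetoid

namespace Ladder

/-- The class of a formula in the ladder. -/
def mk (A : PropFormula Unit) : Ladder := Quotient.mk ladderSetoid A

instance : LE Ladder where
  le := Quotient.lift₂ (fun A B => ∀ (H : HeytAlg.{0}) (v : Unit → H), A.eval v ≤ B.eval v)
    (fun _ _ _ _ h k => propext (forall_congr' fun H => forall_congr' fun v => by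
      rw [h H v, k H v]))

theorem mk_le_mk (A B : PropFormula Unit) :
    mk A ≤ mk B ↔ ∀ (H : HeytAlg.{0}) (v : Unit → H), A.eval v ≤ B.eval v := Iff.rfl

instance : HeytingAlgebra Ladder where
  le_refl := by rintro ⟨A⟩; exact fun _ _ => le_rfl
  le_trans := by rintro ⟨A⟩ ⟨B⟩ ⟨C⟩ h k; exact fun H v => (h H v).trans (k H v)
  le_antisymm := by
    rintro ⟨A⟩ ⟨B⟩ h k; exact Quotient.sound fun H v => (h H v).antisymm (k H v)
  sup := Quotient.map₂ PropFormula.or fun _ _ h _ _ k H v => by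
    simp only [PropFormula.eval, h H v, k H v]
  inf := Quotient.map₂ PropFormula.and fun _ _ h _ _ k H v => by
    simp only [PropFormula.eval, h H v, k H v]
  himp := Quotient.map₂ PropFormula.imp fun _ _ h _ _ k H v => by
    simp only [PropFormula.eval, h H v, k H v]
  compl := Quotient.map PropFormula.neg fun _ _ h H v => by
    simp only [PropFormula.eval, h H v]
  top := mk (.imp (.var ()) (.var ()))
  bot := mk (.and (.var ()) (.neg (.var ())))
  le_sup_left := by rintro ⟨A⟩ ⟨B⟩; exact fun _ _ => le_sup_left
  le_sup_right := by rintro ⟨A⟩ ⟨B⟩; exact fun _ _ => le_sup_right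
  sup_le := by rintro ⟨A⟩ ⟨B⟩ ⟨C⟩ h k; exact fun H v => sup_le (h H v) (k H v)
  inf_le_left := by rintro ⟨A⟩ ⟨B⟩; exact fun _ _ => inf_le_left
  inf_le_right := by rintro ⟨A⟩ ⟨B⟩; exact fun _ _ => inf_le_right
  le_inf := by rintro ⟨A⟩ ⟨B⟩ ⟨C⟩ h k; exact fun H v => le_inf (h H v) (k H v)
  le_top := by rintro ⟨A⟩; exact fun _ _ => le_top.trans himp_self.ge
  bot_le := by rintro ⟨A⟩; exact fun _ _ => inf_compl_self _ |>.le.trans bot_le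
  le_himp_iff := by
    rintro ⟨A⟩ ⟨B⟩ ⟨C⟩
    exact forall_congr' fun H => forall_congr' fun v => le_himp_iff
  himp_bot := by
    rintro ⟨A⟩
    exact Quotient.sound fun H v => by simp [PropFormula.eval]

end Ladder

/-- The algebra `Z × Z₂ + C`, where `Z` is the Rieger–Nishimura ladder and `Z₂` is the two-element
Boolean algebra. -/
noncomputable def ladderConcat (C : Type) [HeytingAlgebra C] : HeytAlg.{0} :=
  HeytAlg.of (Concat (Ladder × Bool) C)

end HeytingVarieties

open HeytingVarieties

/-! Infinity, membership and non-isomorphism are structural. `Z × Z₂ + C` is a quotient of `Z × Z₂ +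
Z`, because a one-generated `C` is a quotient of `Z`. The glued element is determined by the order
(`glue_le`), so the size of `C` is an isomorphism invariant. Explicit Nishimura normal forms show
that a finite quotient of the ladder has a least kernel element, and that a quotient of odd size at
least 3 has a greatest element below `⊤`. The concatenation inherits that element, hence is
subdirectly irreducible.

The substance is finite presentability. Take generators `c = (0, 1)`, `x = (g, 0)` and `y`
generating `C`. The presentation consists of `LadderRelations`, of `c ⊔ cᶜ ≤ y`, and of the kernel
generator of `C` with negation read relative to `c ⊔ cᶜ`. By `validIn_generatedVariety` it suffices
to test valuations in `Z × Z₂ + Z`, and one does so after passing to quotients in which the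
presentation holds.

There the relations are rigid. In a one-generated algebra they force `c ⊔ cᶜ = ⊤`
(`LadderRelations.sup_compl_eq_top`). In a concatenation over `Z × Z₂` with nontrivial top part they
leave only that case or the intended pair (`ladderRelations_concat_cases`). If `c` is complemented,
the two factors below `c` and `cᶜ` receive images of `Z₂` and `Z`, so any `B` true at the generators
remains true. For the intended pair, `B` is transported by `eval_stdVal_eq_top`. `eval_le_eval`
assembles the cases. -/

namespace HeytingVarieties

universe u

/-! ### Homomorphisms, formulas and generating sets. -/

section Homomorphisms

variable {H K : Type*} [HeytingAlgebra H] [HeytingAlgebra K]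

theorem map_eval {α : Type} (f : HeytingHom H K) (v : α → H) (A : PropFormula α) :
    f (A.eval v) = A.eval (fun i => f (v i)) := by
  induction A with
  | var p => rfl
  | and A B hA hB => simp [PropFormula.eval, hA, hB]
  | or A B hA hB => simp [PropFormula.eval, hA, hB]
  | imp A B hA hB => simp [PropFormula.eval, hA, hB]
  | neg A hA => simp [PropFormula.eval, hA]

theorem IsSubalgebra.preimage {S : Set K} (hS : IsSubalgebra S) (f : HeytingHom H K) :
    IsSubalgebra (f ⁻¹' S) where
  inf_mem x hx y hy := by simpa using hS.inf_mem _ hx _ hy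
  sup_mem x hx y hy := by simpa using hS.sup_mem _ hx _ hy
  himp_mem x hx y hy := by simpa using hS.himp_mem _ hx _ hy
  compl_mem x hx := by simpa using hS.compl_mem _ hx

theorem Generates.image {G : Set H} (hG : Generates G) (f : HeytingHom H K)
    (hf : Function.Surjective f) : Generates (f '' G) := by
  intro S hS hGS
  have := hG _ (hS.preimage f) (Set.image_subset_iff.1 hGS)
  refine Set.eq_univ_of_forall fun y => ?_
  obtain ⟨x, rfl⟩ := hf y
  exact (this ▸ Set.mem_univ x : x ∈ f ⁻¹' S)

theorem range_isSubalgebra (f : HeytingHom H K) : IsSubalgebra (Set.range f) where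
  inf_mem := by rintro _ ⟨x, rfl⟩ _ ⟨y, rfl⟩; exact ⟨x ⊓ y, map_inf f x y⟩
  sup_mem := by rintro _ ⟨x, rfl⟩ _ ⟨y, rfl⟩; exact ⟨x ⊔ y, map_sup f x y⟩
  himp_mem := by rintro _ ⟨x, rfl⟩ _ ⟨y, rfl⟩; exact ⟨x ⇨ y, map_himp f x y⟩
  compl_mem := by rintro _ ⟨x, rfl⟩; exact ⟨xᶜ, map_compl f x⟩

/-- The first projection of a product. -/
def fstHom (H K : Type*) [HeytingAlgebra H] [HeytingAlgebra K] : HeytingHom (H × K) H where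
  toFun := Prod.fst
  map_sup' _ _ := rfl
  map_inf' _ _ := rfl
  map_bot' := rfl
  map_himp' _ _ := rfl

/-- The second projection of a product. -/
def sndHom (H K : Type*) [HeytingAlgebra H] [HeytingAlgebra K] : HeytingHom (H × K) K where
  toFun := Prod.snd
  map_sup' _ _ := rfl
  map_inf' _ _ := rfl
  map_bot' := rfl
  map_himp' _ _ := rfl

/-- The unique homomorphism from the two-element algebra. -/
def boolHom (H : Type*) [HeytingAlgebra H] : HeytingHom Bool H where
  toFun b := if b then ⊤ else ⊥
  map_sup' a b := by cases a <;> cases b <;> simp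
  map_inf' a b := by cases a <;> cases b <;> simp
  map_bot' := rfl
  map_himp' a b := by cases a <;> cases b <;> simp [himp_eq]

end Homomorphisms

/-! ### Principal quotients. -/

/-- The elements below `a`, as a quotient of the algebra by the principal filter of `a`. -/
def Below {H : Type u} [HeytingAlgebra H] (a : H) : Type u := {x : H // x ≤ a}

namespace Below

variable {H : Type u} [HeytingAlgebra H] (a : H)

instance : PartialOrder (Below a) := inferInstanceAs (PartialOrder {x : H // x ≤ a})

instance : HeytingAlgebra (Below a) where
  sup x y := ⟨x.1 ⊔ y.1, sup_le x.2 y.2⟩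
  inf x y := ⟨x.1 ⊓ y.1, inf_le_left.trans x.2⟩
  top := ⟨a, le_rfl⟩
  bot := ⟨⊥, bot_le⟩
  himp x y := ⟨(x.1 ⇨ y.1) ⊓ a, inf_le_right⟩
  compl x := ⟨(x.1 ⇨ ⊥) ⊓ a, inf_le_right⟩
  le_sup_left x y := (le_sup_left : x.1 ≤ x.1 ⊔ y.1)
  le_sup_right x y := (le_sup_right : y.1 ≤ x.1 ⊔ y.1)
  sup_le _ _ _ h k := (sup_le h k : _ ≤ _)
  inf_le_left x y := (inf_le_left : x.1 ⊓ y.1 ≤ x.1)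
  inf_le_right x y := (inf_le_right : x.1 ⊓ y.1 ≤ y.1)
  le_inf _ _ _ h k := (le_inf h k : _ ≤ _)
  le_top x := x.2
  bot_le x := (bot_le : ⊥ ≤ x.1)
  himp_bot _ := rfl
  le_himp_iff x y z := by
    change x.1 ≤ (y.1 ⇨ z.1) ⊓ a ↔ x.1 ⊓ y.1 ≤ z.1
    rw [le_inf_iff, le_himp_iff]
    exact and_iff_left x.2

/-- The quotient map onto the elements below `a`. -/
def proj : HeytingHom H (Below a) where
  toFun x := ⟨x ⊓ a, inf_le_right⟩
  map_sup' x y := Subtype.ext (inf_sup_right x y a)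
  map_inf' x y := Subtype.ext (inf_inf_distrib_right x y a)
  map_bot' := Subtype.ext (bot_inf_eq a)
  map_himp' x y := Subtype.ext <| by
    change (x ⇨ y) ⊓ a = (x ⊓ a ⇨ y ⊓ a) ⊓ a
    apply le_antisymm
    · refine le_inf (le_himp_iff.2 (le_inf ?_ (inf_le_right.trans inf_le_right))) inf_le_right
      calc (x ⇨ y) ⊓ a ⊓ (x ⊓ a) ≤ (x ⇨ y) ⊓ x := inf_le_inf inf_le_left inf_le_left
        _ ≤ y := himp_inf_le
    · refine le_inf (le_himp_iff.2 ?_) inf_le_right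
      calc (x ⊓ a ⇨ y ⊓ a) ⊓ a ⊓ x = (x ⊓ a ⇨ y ⊓ a) ⊓ (x ⊓ a) := by
            rw [inf_assoc, inf_comm a x]
        _ ≤ y ⊓ a := himp_inf_le
        _ ≤ y := inf_le_left

theorem proj_surjective : Function.Surjective (proj a) := fun x =>
  ⟨x.1, Subtype.ext (inf_eq_left.2 x.2)⟩

variable {a}

theorem proj_eq_top {x : H} : proj a x = ⊤ ↔ a ≤ x := by
  refine ⟨fun h => ?_, fun h => Subtype.ext (inf_eq_right.2 h)⟩
  exact inf_eq_right.1 (congrArg Subtype.val h)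

theorem proj_eq_bot {x : H} : proj a x = ⊥ ↔ x ⊓ a = ⊥ :=
  ⟨fun h => congrArg Subtype.val h, fun h => Subtype.ext h⟩

end Below

/-! ### Operations and maps of concatenations. -/

namespace Concat

variable {A B C : Type u} [HeytingAlgebra A] [HeytingAlgebra B] [HeytingAlgebra C]

@[simp] theorem fst_sup (x y : Concat A B) : (x ⊔ y).fst = x.fst ⊔ y.fst := rfl
@[simp] theorem snd_sup (x y : Concat A B) : (x ⊔ y).snd = x.snd ⊔ y.snd := rfl
@[simp] theorem fst_inf (x y : Concat A B) : (x ⊓ y).fst = x.fst ⊓ y.fst := rfl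
@[simp] theorem snd_inf (x y : Concat A B) : (x ⊓ y).snd = x.snd ⊓ y.snd := rfl
@[simp] theorem fst_top : (⊤ : Concat A B).fst = ⊤ := rfl
@[simp] theorem snd_top : (⊤ : Concat A B).snd = ⊤ := rfl
@[simp] theorem fst_bot : (⊥ : Concat A B).fst = ⊥ := rfl
@[simp] theorem snd_bot : (⊥ : Concat A B).snd = ⊥ := rfl
@[simp] theorem fst_himp (x y : Concat A B) : (x ⇨ y).fst = x.fst ⇨ y.fst := rfl

open Classical in
@[simp] theorem snd_himp (x y : Concat A B) :
    (x ⇨ y).snd = if x.fst ≤ y.fst then x.snd ⇨ y.snd else ⊥ := rfl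

@[simp] theorem fst_compl (x : Concat A B) : (xᶜ).fst = (x.fst)ᶜ := himp_bot _

open Classical in
@[simp] theorem snd_compl (x : Concat A B) :
    (xᶜ).snd = if x.fst = ⊥ then (x.snd)ᶜ else ⊥ := by
  change (if x.fst ≤ ⊥ then x.snd ⇨ ⊥ else ⊥) = _
  simp

/-- The element of the concatenation coming from the lower summand. -/
def inl (B : Type u) [HeytingAlgebra B] (a : A) : Concat A B := ⟨a, ⊥, Or.inr rfl⟩

/-- The element of the concatenation coming from the upper summand. -/
def inr (A : Type u) [HeytingAlgebra A] (b : B) : Concat A B := ⟨⊤, b, Or.inl rfl⟩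

@[simp] theorem fst_inl (a : A) : (inl B a).fst = a := rfl
@[simp] theorem snd_inl (a : A) : (inl B a).snd = ⊥ := rfl
@[simp] theorem fst_inr (b : B) : (inr A b).fst = ⊤ := rfl
@[simp] theorem snd_inr (b : B) : (inr A b).snd = b := rfl

theorem eq_inl {x : Concat A B} (h : x.snd = ⊥) : x = inl B x.fst := Concat.ext rfl h

theorem eq_inr {x : Concat A B} (h : x.fst = ⊤) : x = inr A x.snd := Concat.ext h rfl

/-- The quotient map collapsing the upper summand. -/
def fstHom (A B : Type u) [HeytingAlgebra A] [HeytingAlgebra B] : HeytingHom (Concat A B) A where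
  toFun := Concat.fst
  map_sup' _ _ := rfl
  map_inf' _ _ := rfl
  map_bot' := rfl
  map_himp' _ _ := rfl

/-- The map of concatenations induced by a homomorphism of the upper summands. -/
def mapHom (A : Type u) [HeytingAlgebra A] (f : HeytingHom B C) :
    HeytingHom (Concat A B) (Concat A C) where
  toFun x := ⟨x.fst, f x.snd, x.glue.imp_right fun h => by rw [h, map_bot]⟩
  map_sup' _ _ := Concat.ext rfl (map_sup f _ _)
  map_inf' _ _ := Concat.ext rfl (map_inf f _ _)
  map_bot' := Concat.ext rfl (map_bot f)
  map_himp' x y := by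
    refine Concat.ext rfl ?_
    by_cases h : x.fst ≤ y.fst <;> simp [h]

@[simp] theorem fst_mapHom (f : HeytingHom B C) (x : Concat A B) :
    (mapHom A f x).fst = x.fst := rfl

@[simp] theorem snd_mapHom (f : HeytingHom B C) (x : Concat A B) :
    (mapHom A f x).snd = f x.snd := rfl

theorem mapHom_surjective (f : HeytingHom B C) (hf : Function.Surjective f) :
    Function.Surjective (mapHom A f) := by
  intro y
  rcases y.glue with h | h
  · obtain ⟨b, hb⟩ := hf y.snd
    exact ⟨inr A b, Concat.ext h.symm hb⟩
  · exact ⟨inl B y.fst, Concat.ext rfl (by simp [h])⟩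

theorem le_inl_top_or (x : Concat A B) : x ≤ inl B ⊤ ∨ inl B ⊤ ≤ x := by
  rcases x.glue with h | h
  · exact Or.inr ⟨h.ge, bot_le⟩
  · exact Or.inl ⟨le_top, h.le⟩

end Concat

/-! ### Universal property of the ladder. -/

namespace Ladder

/-- The generator of the ladder. -/
def gen : Ladder := mk (.var ())

theorem generates_gen : Generates ({gen} : Set Ladder) := by
  intro S hS hg
  refine Set.eq_univ_of_forall ?_
  rintro ⟨A⟩
  change mk A ∈ S
  induction A with
  | var p => exact hg rfl
  | and A B hA hB => exact hS.inf_mem _ hA _ hB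
  | or A B hA hB => exact hS.sup_mem _ hA _ hB
  | imp A B hA hB => exact hS.himp_mem _ hA _ hB
  | neg A hA => exact hS.compl_mem _ hA

/-- The homomorphism from the ladder sending the generator to `x`. -/
def lift {H : Type} [HeytingAlgebra H] (x : H) : HeytingHom Ladder H where
  toFun := Quotient.lift (fun A : PropFormula Unit => A.eval fun _ => x)
    fun _ _ h => h (HeytAlg.of H) fun _ => x
  map_sup' := by rintro ⟨A⟩ ⟨B⟩; rfl
  map_inf' := by rintro ⟨A⟩ ⟨B⟩; rfl
  map_bot' := inf_compl_self _
  map_himp' := by rintro ⟨A⟩ ⟨B⟩; rfl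

variable {H : Type} [HeytingAlgebra H]

theorem lift_mk (x : H) (A : PropFormula Unit) : lift x (mk A) = A.eval fun _ => x := rfl

@[simp] theorem lift_gen (x : H) : lift x gen = x := rfl

theorem lift_surjective {x : H} (hx : Generates ({x} : Set H)) :
    Function.Surjective (lift x) :=
  Set.range_eq_univ.1 (hx _ (range_isSubalgebra _) (by rintro _ rfl; exact ⟨gen, rfl⟩))

theorem generates_map (f : HeytingHom Ladder H) (hf : Function.Surjective f) :
    Generates ({f gen} : Set H) := by
  simpa using generates_gen.image f hf

end Ladder

/-! ### Nishimura normal forms in one-generated algebras. -/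

section Nishimura

variable {H : Type*} [HeytingAlgebra H] (x : H)

/-- The Nishimura elements of a Heyting algebra with a distinguished element `x`: the pairs
`(o n, e n)` with `o 0 = ⊥`, `e 0 = x`, `o (n + 1) = o n ⊔ e n` and `e (n + 1) = e n ⇨ o n`. -/
def nishimura : ℕ → H × H
  | 0 => (⊥, x)
  | n + 1 => ((nishimura n).1 ⊔ (nishimura n).2, (nishimura n).2 ⇨ (nishimura n).1)

/-- The Nishimura elements forming a chain. -/
def rnO (n : ℕ) : H := (nishimura x n).1

/-- The join-irreducible Nishimura elements. -/
def rnE (n : ℕ) : H := (nishimura x n).2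

@[simp] theorem rnO_zero : rnO x 0 = ⊥ := rfl
@[simp] theorem rnE_zero : rnE x 0 = x := rfl
theorem rnO_succ (n : ℕ) : rnO x (n + 1) = rnO x n ⊔ rnE x n := rfl
theorem rnE_succ (n : ℕ) : rnE x (n + 1) = rnE x n ⇨ rnO x n := rfl

theorem rnO_mono : Monotone (rnO x) :=
  monotone_nat_of_le_succ fun _ => le_sup_left

theorem rnE_le_rnO {m n : ℕ} (h : m < n) : rnE x m ≤ rnO x n :=
  le_trans le_sup_right (rnO_mono x (Nat.succ_le_of_lt h))

theorem rnO_le_rnE {m n : ℕ} (h : m < n) : rnO x m ≤ rnE x n := by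
  obtain ⟨k, rfl⟩ : ∃ k, n = k + 1 := ⟨n - 1, by omega⟩
  exact (rnO_mono x (Nat.lt_succ_iff.1 h)).trans le_himp

theorem rnE_le_rnE {m n : ℕ} (h : m + 2 ≤ n) : rnE x m ≤ rnE x n :=
  (rnE_le_rnO x (Nat.lt_succ_self m)).trans (rnO_le_rnE x (by omega))

/-- Truncated subtraction is intended: for `n = 0` both sides are `⊥`. -/
theorem rnE_inf_rnO (n : ℕ) : rnE x n ⊓ rnO x n = rnO x (n - 1) := by
  cases n with
  | zero => simp
  | succ n =>
    refine le_antisymm ?_ (le_inf (rnO_le_rnE x (by omega)) (rnO_mono x (by omega)))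
    rw [rnO_succ, inf_sup_left]
    exact sup_le inf_le_right himp_inf_le

theorem rnE_inf_rnE_succ (n : ℕ) : rnE x n ⊓ rnE x (n + 1) = rnO x (n - 1) := by
  apply le_antisymm
  · rw [← rnE_inf_rnO]
    refine le_inf inf_le_left ?_
    rw [inf_comm]
    exact himp_inf_le
  · refine le_inf ?_ (rnO_le_rnE x (by omega))
    rw [← rnE_inf_rnO]
    exact inf_le_left

theorem rnE_sup_rnE_succ (n : ℕ) : rnE x n ⊔ rnE x (n + 1) = rnO x (n + 2) := by
  rw [rnO_succ, rnO_succ, sup_assoc]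
  exact (sup_eq_right.2 ((rnO_le_rnE x (by omega : n < n + 1)).trans le_sup_right)).symm

theorem rnE_himp_rnO_pred (n : ℕ) : rnE x (n + 1) ⇨ rnO x n = rnE x (n + 2) := by
  rw [rnE_succ x (n + 1)]
  refine le_antisymm (himp_le_himp_left (rnO_mono x (by omega))) (le_himp_iff.2 ?_)
  calc (rnE x (n + 1) ⇨ rnO x (n + 1)) ⊓ rnE x (n + 1)
      ≤ rnE x (n + 1) ⊓ rnO x (n + 1) := le_inf inf_le_right himp_inf_le
    _ ≤ rnO x n := (rnE_inf_rnO x (n + 1)).le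

theorem rnE_himp_rnO_two (n : ℕ) : rnE x (n + 2) ⇨ rnO x n = rnE x (n + 1) := by
  apply le_antisymm
  · rw [rnE_succ x n]
    exact himp_le_himp_right (rnE_le_rnE x le_rfl)
  · rw [le_himp_iff, rnE_inf_rnE_succ]
    simp

/-- The implication already lies below `e (n + 1)`, hence below its own premise `e m`, so modus
ponens applies to it. -/
theorem rnE_himp_rnO_far {m n : ℕ} (h : n + 3 ≤ m) : rnE x m ⇨ rnO x n = rnO x n := by
  refine le_antisymm ?_ le_himp
  have h1 : rnE x m ⇨ rnO x n ≤ rnE x (n + 1) := by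
    rw [rnE_succ]
    exact himp_le_himp_right (rnE_le_rnE x (by omega))
  have h2 : rnE x (n + 1) ≤ rnE x m := rnE_le_rnE x (by omega)
  calc rnE x m ⇨ rnO x n ≤ (rnE x m ⇨ rnO x n) ⊓ rnE x m := le_inf le_rfl (h1.trans h2)
    _ ≤ rnO x n := himp_inf_le

theorem rnE_himp_rnE_succ (n : ℕ) : rnE x n ⇨ rnE x (n + 1) = rnE x (n + 1) := by
  refine le_antisymm ?_ le_himp
  rw [rnE_succ, le_himp_iff, ← rnE_succ]
  calc (rnE x n ⇨ rnE x (n + 1)) ⊓ rnE x n ≤ rnE x (n + 1) ⊓ rnE x n :=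
        le_inf himp_inf_le inf_le_right
    _ ≤ rnO x n := himp_inf_le

theorem rnE_himp_rnE_of_lt {m n : ℕ} (h : n + 2 ≤ m) :
    rnE x m ⇨ rnE x (n + 1) = rnE x (n + 1) := by
  refine le_antisymm ?_ le_himp
  calc rnE x m ⇨ rnE x (n + 1) ≤ rnE x n ⇨ rnE x (n + 1) := himp_le_himp_right (rnE_le_rnE x h)
    _ = _ := rnE_himp_rnE_succ x n

/-- The set of all Nishimura elements. -/
def rnSet : Set H := {z | z = ⊤ ∨ (∃ n, z = rnO x n) ∨ ∃ n, z = rnE x n}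

theorem top_mem_rnSet : ⊤ ∈ rnSet x := Or.inl rfl
theorem rnO_mem_rnSet (n : ℕ) : rnO x n ∈ rnSet x := Or.inr (Or.inl ⟨n, rfl⟩)
theorem rnE_mem_rnSet (n : ℕ) : rnE x n ∈ rnSet x := Or.inr (Or.inr ⟨n, rfl⟩)

theorem rnO_rnE_cases (m n : ℕ) :
    rnO x m ⊓ rnE x n ∈ rnSet x ∧ rnO x m ⊔ rnE x n ∈ rnSet x := by
  rcases lt_trichotomy m n with h | rfl | h
  · have := rnO_le_rnE x h
    rw [inf_eq_left.2 this, sup_eq_right.2 this]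
    exact ⟨rnO_mem_rnSet x m, rnE_mem_rnSet x n⟩
  · rw [inf_comm, rnE_inf_rnO]
    exact ⟨rnO_mem_rnSet x _, rnO_mem_rnSet x (m + 1)⟩
  · have := rnE_le_rnO x h
    rw [inf_eq_right.2 this, sup_eq_left.2 this]
    exact ⟨rnE_mem_rnSet x n, rnO_mem_rnSet x m⟩

theorem rnE_rnE_cases (m n : ℕ) :
    rnE x m ⊓ rnE x n ∈ rnSet x ∧ rnE x m ⊔ rnE x n ∈ rnSet x := by
  wlog hmn : m ≤ n generalizing m n
  · rw [inf_comm, sup_comm]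
    exact this n m (by omega)
  obtain rfl | rfl | h : m = n ∨ n = m + 1 ∨ m + 2 ≤ n := by omega
  · rw [inf_idem, sup_idem]
    exact ⟨rnE_mem_rnSet x m, rnE_mem_rnSet x m⟩
  · rw [rnE_inf_rnE_succ, rnE_sup_rnE_succ]
    exact ⟨rnO_mem_rnSet x _, rnO_mem_rnSet x _⟩
  · have := rnE_le_rnE x h
    rw [inf_eq_left.2 this, sup_eq_right.2 this]
    exact ⟨rnE_mem_rnSet x m, rnE_mem_rnSet x n⟩

theorem rnO_rnO_cases (m n : ℕ) :
    rnO x m ⊓ rnO x n ∈ rnSet x ∧ rnO x m ⊔ rnO x n ∈ rnSet x := by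
  wlog hmn : m ≤ n generalizing m n
  · rw [inf_comm, sup_comm]
    exact this n m (by omega)
  rw [inf_eq_left.2 (rnO_mono x hmn), sup_eq_right.2 (rnO_mono x hmn)]
  exact ⟨rnO_mem_rnSet x m, rnO_mem_rnSet x n⟩

theorem rnSet_inf_sup {y z : H} (hy : y ∈ rnSet x) (hz : z ∈ rnSet x) :
    y ⊓ z ∈ rnSet x ∧ y ⊔ z ∈ rnSet x := by
  rcases hy with rfl | ⟨m, rfl⟩ | ⟨m, rfl⟩
  · simpa using ⟨hz, top_mem_rnSet x⟩
  · rcases hz with rfl | ⟨n, rfl⟩ | ⟨n, rfl⟩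
    · simpa using ⟨rnO_mem_rnSet x m, top_mem_rnSet x⟩
    · exact rnO_rnO_cases x m n
    · exact rnO_rnE_cases x m n
  · rcases hz with rfl | ⟨n, rfl⟩ | ⟨n, rfl⟩
    · simpa using ⟨rnE_mem_rnSet x m, top_mem_rnSet x⟩
    · rw [inf_comm, sup_comm]
      exact rnO_rnE_cases x n m
    · exact rnE_rnE_cases x m n

theorem rnE_himp_rnO_mem (m n : ℕ) : rnE x m ⇨ rnO x n ∈ rnSet x := by
  obtain h | rfl | rfl | rfl | h :
      m < n ∨ m = n ∨ m = n + 1 ∨ m = n + 2 ∨ n + 3 ≤ m := by omega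
  · rw [himp_eq_top_iff.2 (rnE_le_rnO x h)]
    exact top_mem_rnSet x
  · exact rnE_mem_rnSet x (m + 1)
  · rw [rnE_himp_rnO_pred]
    exact rnE_mem_rnSet x _
  · rw [rnE_himp_rnO_two]
    exact rnE_mem_rnSet x _
  · rw [rnE_himp_rnO_far x h]
    exact rnO_mem_rnSet x n

theorem rnE_himp_rnE_mem (m n : ℕ) : rnE x m ⇨ rnE x n ∈ rnSet x := by
  cases n with
  | zero =>
    -- The generator is also a member of the chain, which reduces this case to the previous lemma.
    have : rnE x 0 = rnO x 1 := by simp [rnO_succ]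
    rw [this]
    exact rnE_himp_rnO_mem x m 1
  | succ n =>
    obtain h | rfl | rfl | h : m + 1 ≤ n ∨ m = n ∨ m = n + 1 ∨ n + 2 ≤ m := by omega
    · rw [himp_eq_top_iff.2 (rnE_le_rnE x (by omega))]
      exact top_mem_rnSet x
    · rw [rnE_himp_rnE_succ]
      exact rnE_mem_rnSet x _
    · rw [himp_self]
      exact top_mem_rnSet x
    · rw [rnE_himp_rnE_of_lt x h]
      exact rnE_mem_rnSet x _

theorem rnE_himp_mem (m : ℕ) {z : H} (hz : z ∈ rnSet x) : rnE x m ⇨ z ∈ rnSet x := by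
  rcases hz with rfl | ⟨n, rfl⟩ | ⟨n, rfl⟩
  · rw [himp_top]
    exact top_mem_rnSet x
  · exact rnE_himp_rnO_mem x m n
  · exact rnE_himp_rnE_mem x m n

/-- Each `o m` is a finite join of elements `e k`, so the implication is a finite meet of
implications already treated. -/
theorem rnO_himp_mem (m : ℕ) {z : H} (hz : z ∈ rnSet x) : rnO x m ⇨ z ∈ rnSet x := by
  induction m with
  | zero => simpa using top_mem_rnSet x
  | succ m ih =>
    rw [rnO_succ, sup_himp_distrib]
    exact (rnSet_inf_sup x ih (rnE_himp_mem x m hz)).1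

theorem rnSet_himp {y z : H} (hy : y ∈ rnSet x) (hz : z ∈ rnSet x) : y ⇨ z ∈ rnSet x := by
  rcases hy with rfl | ⟨m, rfl⟩ | ⟨m, rfl⟩
  · rwa [top_himp]
  · exact rnO_himp_mem x m hz
  · exact rnE_himp_mem x m hz

theorem isSubalgebra_rnSet : IsSubalgebra (rnSet x) where
  inf_mem _ hy _ hz := (rnSet_inf_sup x hy hz).1
  sup_mem _ hy _ hz := (rnSet_inf_sup x hy hz).2
  himp_mem _ hy _ hz := rnSet_himp x hy hz
  compl_mem y hy := by
    rw [← himp_bot]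
    exact rnSet_himp x hy (rnO_mem_rnSet x 0)

variable {x}

/-- Every element of an algebra generated by `x` is a Nishimura element. -/
theorem Generates.mem_rnSet (hx : Generates ({x} : Set H)) (z : H) :
    z = ⊤ ∨ (∃ n, z = rnO x n) ∨ ∃ n, z = rnE x n :=
  Set.eq_univ_iff_forall.1
    (hx _ (isSubalgebra_rnSet x) (Set.singleton_subset_iff.2 (rnE_mem_rnSet x 0))) z

theorem map_nishimura {K : Type*} [HeytingAlgebra K] (f : HeytingHom H K) (n : ℕ) :
    f (rnO x n) = rnO (f x) n ∧ f (rnE x n) = rnE (f x) n := by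
  induction n with
  | zero => simp
  | succ n ih => simp [rnO_succ, rnE_succ, ih.1, ih.2]

/-- Apart from `⊥`, `x`, `xᶜ` and `xᶜᶜ`, all elements of an algebra generated by `x` lie above
`x ⊔ xᶜ`. -/
theorem Generates.cases_bottom (hx : Generates ({x} : Set H)) (z : H) :
    z = ⊥ ∨ z = x ∨ z = xᶜ ∨ z = xᶜᶜ ∨ x ⊔ xᶜ ≤ z := by
  have e1 : rnE x 1 = xᶜ := by simp [rnE_succ]
  have o1 : rnO x 1 = x := by simp [rnO_succ]
  have o2 : rnO x 2 = x ⊔ xᶜ := by rw [rnO_succ, e1, o1]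
  have e2 : rnE x 2 = xᶜᶜ := by rw [← rnE_himp_rnO_pred, e1, rnO_zero, himp_bot]
  rcases hx.mem_rnSet z with rfl | ⟨n, rfl⟩ | ⟨n, rfl⟩
  · simp
  · obtain rfl | rfl | h : n = 0 ∨ n = 1 ∨ 2 ≤ n := by omega
    · simp
    · simp [o1]
    · exact Or.inr (Or.inr (Or.inr (Or.inr (o2 ▸ rnO_mono x h))))
  · obtain rfl | rfl | rfl | h : n = 0 ∨ n = 1 ∨ n = 2 ∨ 2 < n := by omega
    · simp
    · simp [e1]
    · simp [e2]
    · exact Or.inr (Or.inr (Or.inr (Or.inr (o2 ▸ rnO_le_rnE x h))))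

/-- Elements above `x ⊔ xᶜ` are dense, so `⊤` is the only regular one among them. -/
theorem Generates.cases_regular (hx : Generates ({x} : Set H)) {z : H} (hz : zᶜᶜ = z) :
    z = ⊥ ∨ z = ⊤ ∨ z = xᶜ ∨ z = xᶜᶜ := by
  rcases hx.cases_bottom z with h | rfl | h | h | h
  · exact Or.inl h
  · exact Or.inr (Or.inr (Or.inr hz.symm))
  · exact Or.inr (Or.inr (Or.inl h))
  · exact Or.inr (Or.inr (Or.inr h))
  · have : zᶜ = ⊥ := by
      refine le_bot_iff.1 ((compl_anti h).trans ?_)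
      simp [compl_sup]
    refine Or.inr (Or.inl ?_)
    rw [← hz, this, compl_bot]

end Nishimura

/-! ### A Kripke model separating the Nishimura elements. -/

/-- The frame of the Rieger–Nishimura ladder: the natural numbers, with `m` below `n` if `m = n`
or `m + 2 ≤ n`. -/
structure LadderFrame : Type where
  /-- The underlying natural number. -/
  val : ℕ

instance : PartialOrder LadderFrame where
  le a b := a.val = b.val ∨ a.val + 2 ≤ b.val
  le_refl _ := Or.inl rfl
  le_trans _ _ _ h k := by omega
  le_antisymm := by
    rintro ⟨a⟩ ⟨b⟩ h k
    congr 1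
    dsimp only at h k
    omega

namespace LadderFrame

theorem le_iff (a b : LadderFrame) : a ≤ b ↔ a.val = b.val ∨ a.val + 2 ≤ b.val := Iff.rfl

theorem mem_himp {s t : LowerSet LadderFrame} {k : LadderFrame} :
    k ∈ s ⇨ t ↔ ∀ j ≤ k, j ∈ s → j ∈ t := by
  rw [← LowerSet.Iic_le, le_himp_iff]
  exact ⟨fun h j hj hs => h ⟨hj, hs⟩, fun h j hj => h j hj.1 hj.2⟩

/-- With the generator read as the down-set of `0`, `o n` is the initial segment `{k < n}` and `e n`
the principal down-set of `n`. -/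
theorem mem_nishimura (n : ℕ) (k : LadderFrame) :
    (k ∈ rnO (LowerSet.Iic (⟨0⟩ : LadderFrame)) n ↔ k.val < n) ∧
      (k ∈ rnE (LowerSet.Iic (⟨0⟩ : LadderFrame)) n ↔ k.val = n ∨ k.val + 2 ≤ n) := by
  induction n generalizing k with
  | zero => simp [LowerSet.mem_Iic_iff, le_iff]
  | succ n ih =>
    rw [rnO_succ, rnE_succ, mem_himp, LowerSet.mem_sup_iff, (ih k).1, (ih k).2]
    refine ⟨by omega, ?_⟩
    simp only [(ih _).1, (ih _).2, le_iff]
    constructor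
    · intro h
      -- The point `n` is the only member of `e n` outside `o n`, so the condition says exactly that
      -- `n` is not below `k`.
      have h1 := h ⟨n⟩
      have h2 := h k (Or.inl rfl)
      dsimp only at h1
      omega
    · intro h j hj
      omega

end LadderFrame

/-! ### Principal ideals and finite quotients of the ladder. -/

namespace Ladder

theorem not_rnE_le_rnO (n : ℕ) : ¬ rnE gen n ≤ rnO gen n := by
  intro h
  have h1 := OrderHomClass.mono (lift (LowerSet.Iic (⟨0⟩ : LadderFrame))) h
  rw [(map_nishimura _ n).1, (map_nishimura _ n).2, lift_gen] at h1
  have h2 := h1 (((LadderFrame.mem_nishimura n ⟨n⟩).2).2 (Or.inl rfl))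
  exact absurd (((LadderFrame.mem_nishimura n ⟨n⟩).1).1 h2) (lt_irrefl n)

theorem rnO_strictMono : StrictMono (rnO gen) :=
  strictMono_nat_of_lt_succ fun n =>
    lt_of_le_not_ge le_sup_left fun h => not_rnE_le_rnO n (le_sup_right.trans h)

theorem rnO_ne_top (n : ℕ) : rnO gen n ≠ ⊤ := fun h => not_rnE_le_rnO n (h ▸ le_top)

theorem not_rnE_le_rnE_succ (n : ℕ) : ¬ rnE gen n ≤ rnE gen (n + 1) := by
  intro h
  refine not_rnE_le_rnO n ?_
  rw [← inf_eq_left.2 h, rnE_inf_rnE_succ]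
  exact rnO_mono _ (by omega)

theorem not_rnE_le_rnO_of_le {m n : ℕ} (h : n ≤ m) : ¬ rnE gen m ≤ rnO gen n :=
  fun h' => not_rnE_le_rnO m (h'.trans (rnO_mono _ h))

instance : Infinite Ladder := Infinite.of_injective _ rnO_strictMono.injective

theorem Iic_rnO_succ (n : ℕ) :
    Set.Iic (rnO gen (n + 1)) =
      insert (rnO gen (n + 1)) (insert (rnE gen n) (Set.Iic (rnO gen n))) := by
  ext z
  simp only [Set.mem_Iic, Set.mem_insert_iff]
  constructor
  · intro hz
    rcases generates_gen.mem_rnSet z with rfl | ⟨k, rfl⟩ | ⟨k, rfl⟩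
    · exact absurd (top_le_iff.1 hz) (rnO_ne_top _)
    · rcases Nat.lt_or_eq_of_le (rnO_strictMono.le_iff_le.1 hz) with h | rfl
      · exact Or.inr (Or.inr (rnO_mono _ (Nat.lt_succ_iff.1 h)))
      · exact Or.inl rfl
    · have : k < n + 1 := by
        by_contra hk
        exact not_rnE_le_rnO_of_le (not_lt.1 hk) hz
      rcases Nat.lt_or_eq_of_le (Nat.lt_succ_iff.1 this) with h | rfl
      · exact Or.inr (Or.inr (rnE_le_rnO _ h))
      · exact Or.inr (Or.inl rfl)
  · rintro (rfl | rfl | h)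
    · exact le_rfl
    · exact le_sup_right
    · exact h.trans le_sup_left

theorem Iic_rnE_succ (n : ℕ) :
    Set.Iic (rnE gen (n + 1)) = insert (rnE gen (n + 1)) (Set.Iic (rnO gen n)) := by
  ext z
  simp only [Set.mem_Iic, Set.mem_insert_iff]
  constructor
  · intro hz
    have h1 : z ∈ Set.Iic (rnO gen (n + 1 + 1)) := hz.trans le_sup_right
    rw [Iic_rnO_succ, Iic_rnO_succ] at h1
    rcases h1 with rfl | h | rfl | rfl | h
    · exact absurd (le_trans (le_trans le_sup_right le_sup_left) hz) (not_rnE_le_rnE_succ n)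
    · exact Or.inl h
    · exact absurd (le_trans le_sup_right hz) (not_rnE_le_rnE_succ n)
    · exact absurd hz (not_rnE_le_rnE_succ n)
    · exact Or.inr h
  · rintro (rfl | h)
    · exact le_rfl
    · exact h.trans le_himp

theorem ncard_Iic_rnO (n : ℕ) :
    (Set.Iic (rnO gen (n + 1))).Finite ∧ (Set.Iic (rnO gen (n + 1))).ncard = 2 * (n + 1) := by
  induction n with
  | zero =>
    rw [Iic_rnO_succ]
    have h : insert (rnO gen (0 + 1)) (insert (rnE gen 0) (Set.Iic (rnO gen 0))) =
        ({gen, ⊥} : Set Ladder) := by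
      simp [rnO_succ]
    rw [h]
    refine ⟨by simp, Set.ncard_pair fun h => not_rnE_le_rnO 0 h.le⟩
  | succ n ih =>
    rw [Iic_rnO_succ]
    have h1 : rnE gen (n + 1) ∉ Set.Iic (rnO gen (n + 1)) := not_rnE_le_rnO _
    have h2 : rnO gen (n + 1 + 1) ∉ insert (rnE gen (n + 1)) (Set.Iic (rnO gen (n + 1))) := by
      rintro (h | h)
      · exact not_rnE_le_rnE_succ n (h ▸ rnE_le_rnO _ (by omega))
      · exact (rnO_strictMono (Nat.lt_succ_self (n + 1))).not_ge h
    refine ⟨(ih.1.insert _).insert _, ?_⟩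
    rw [Set.ncard_insert_of_notMem h2 (ih.1.insert _), Set.ncard_insert_of_notMem h1 ih.1, ih.2]
    omega

theorem ncard_Iic_rnE (n : ℕ) : (Set.Iic (rnE gen (n + 2))).ncard = 2 * (n + 1) + 1 := by
  rw [Iic_rnE_succ, Set.ncard_insert_of_notMem _ (ncard_Iic_rnO n).1, (ncard_Iic_rnO n).2]
  exact not_rnE_le_rnO_of_le (by omega)

/-- The kernel of a homomorphism from the ladder to a finite algebra is generated by a Nishimura
element. -/
theorem exists_least_ker {C : Type} [HeytingAlgebra C] [Finite C] (f : HeytingHom Ladder C) :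
    ∃ a, (∀ z, f z = ⊤ ↔ a ≤ z) ∧ ((∃ n, a = rnO gen n) ∨ ∃ n, a = rnE gen n) := by
  suffices h : ∃ a, f a = ⊤ ∧ (∀ z, f z = ⊤ → a ≤ z) ∧
      ((∃ n, a = rnO gen n) ∨ ∃ n, a = rnE gen n) by
    obtain ⟨a, h1, h2, h3⟩ := h
    exact ⟨a, fun z => ⟨h2 z, fun hz => top_le_iff.1 (h1 ▸ OrderHomClass.mono f hz)⟩, h3⟩
  have hex : ∃ n, f (rnO gen n) = ⊤ := by
    -- Pigeonhole: once two chain elements are identified, `e m` collapses into `o m`, so `e (m +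
    -- 1)` and with it `o (m + 2)` go to `⊤`.
    obtain ⟨m, n, hmn, h⟩ := Finite.exists_ne_map_eq_of_infinite fun n => f (rnO gen n)
    wlog hlt : m < n generalizing m n
    · exact this n m hmn.symm h.symm (lt_of_le_of_ne (not_lt.1 hlt) hmn.symm)
    refine ⟨m + 2, ?_⟩
    have h1 : f (rnE gen m) ≤ f (rnO gen m) := by
      have h0 : f (rnO gen m) = f (rnO gen n) := h
      rw [h0]
      exact OrderHomClass.mono f (rnE_le_rnO _ hlt)
    have h2 : f (rnE gen (m + 1)) = ⊤ := by
      rw [rnE_succ, map_himp]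
      exact himp_eq_top_iff.2 h1
    rw [rnO_succ, map_sup, h2, sup_top_eq]
  classical
  obtain ⟨n, hn, hmin⟩ : ∃ n, f (rnO gen n) = ⊤ ∧ ∀ k < n, f (rnO gen k) ≠ ⊤ :=
    ⟨Nat.find hex, Nat.find_spec hex, fun k hk => Nat.find_min hex hk⟩
  cases n with
  | zero => exact ⟨⊥, hn, fun _ _ => bot_le, Or.inl ⟨0, rfl⟩⟩
  | succ m =>
    have hm := hmin m (Nat.lt_succ_self m)
    -- The kernel is a filter avoiding `o m`. This rules out `e k` for `k < m` and for `k = m + 1`,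
    -- so the least kernel element is `e m` or `o (m + 1)`.
    have key : ∀ y z, f y = ⊤ → f z = ⊤ → ¬ y ⊓ z ≤ rnO gen m := fun y z hy hz h =>
      hm (top_le_iff.1 (by simpa [hy, hz] using OrderHomClass.mono f h))
    have hE : ∀ k, f (rnE gen k) = ⊤ → k = m ∨ m + 2 ≤ k := by
      intro k hk
      by_contra hcon
      obtain h | rfl : k < m ∨ k = m + 1 := by omega
      · exact key _ _ hk hk (inf_le_left.trans (rnE_le_rnO _ h))
      · exact key _ _ hk hn (rnE_inf_rnO _ (m + 1)).le
    have hO : ∀ k, f (rnO gen k) = ⊤ → m + 1 ≤ k := fun k hk => not_lt.1 fun h => hmin k h hk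
    by_cases hem : f (rnE gen m) = ⊤
    · refine ⟨rnE gen m, hem, fun z hz => ?_, Or.inr ⟨m, rfl⟩⟩
      rcases generates_gen.mem_rnSet z with rfl | ⟨k, rfl⟩ | ⟨k, rfl⟩
      · exact le_top
      · exact rnE_le_rnO _ (hO k hz)
      · rcases hE k hz with rfl | h
        · exact le_rfl
        · exact rnE_le_rnE _ h
    · refine ⟨rnO gen (m + 1), hn, fun z hz => ?_, Or.inl ⟨m + 1, rfl⟩⟩
      rcases generates_gen.mem_rnSet z with rfl | ⟨k, rfl⟩ | ⟨k, rfl⟩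
      · exact le_top
      · exact rnO_mono _ (hO k hz)
      · rcases hE k hz with rfl | h
        · exact absurd hz hem
        · exact rnO_le_rnE _ h

end Ladder

/-! ### Subdirect irreducibility and algebras of odd size. -/

/-- Some projection does not send `m` to `⊤`. If it identified `x` and `y` with `x ≰ y`, then `x ⇨ y
≤ m` would force it to. -/
theorem subdirectlyIrreducible_of_forall_le {H : Type u} [HeytingAlgebra H] {m : H} (hm : m ≠ ⊤)
    (h : ∀ x : H, x ≠ ⊤ → x ≤ m) : SubdirectlyIrreducible H := by
  intro I B f hf hinj
  obtain ⟨i, hi⟩ : ∃ i, f i m ≠ ⊤ := by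
    by_contra! hcon
    refine hm (hinj (funext fun i => ?_))
    simp [hcon]
  have key : ∀ x y, f i x = f i y → x ≤ y := by
    intro x y hxy
    by_contra hle
    have h1 := OrderHomClass.mono (f i) (h (x ⇨ y) fun h' => hle (himp_eq_top_iff.1 h'))
    rw [map_himp, hxy, himp_self] at h1
    exact hi (top_le_iff.1 h1)
  exact ⟨i, fun x y hxy => (key x y hxy).antisymm (key y x hxy.symm), hf i⟩

namespace Ladder

variable {C : Type} [HeytingAlgebra C]

/-- Every element agrees modulo the kernel with its meet with `a`, so the elements below `a`
represent the classes uniquely. -/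
theorem natCard_of_least_ker {f : HeytingHom Ladder C} (hf : Function.Surjective f) {a : Ladder}
    (ha : ∀ z, f z = ⊤ ↔ a ≤ z) : Nat.card C = (Set.Iic a).ncard := by
  have hfa : f a = ⊤ := (ha a).2 le_rfl
  have key : ∀ y z, y ≤ a → f y = f z → y ≤ z := by
    intro y z hy hyz
    have : a ≤ y ⇨ z := (ha _).1 (by rw [map_himp, hyz, himp_self])
    exact (le_inf (hy.trans this) le_rfl).trans himp_inf_le
  refine (Nat.card_congr (Equiv.ofBijective (fun y : Set.Iic a => f y) ⟨?_, ?_⟩)).symm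
  · rintro ⟨y, hy⟩ ⟨z, hz⟩ hyz
    exact Subtype.ext ((key y z hy hyz).antisymm (key z y hz hyz.symm))
  · intro c
    obtain ⟨z, rfl⟩ := hf c
    exact ⟨⟨z ⊓ a, Set.mem_Iic.2 inf_le_right⟩, by simp [hfa]⟩

end Ladder

/-- Parity decides the kernel generator: the ideal of `o k` has even size for `k ≥ 1`, and size 1
for `k = 0`. So the generator is some `e (k + 1)`, whose only lower cover `o k` becomes the coatom.
-/
theorem OneGenerated.exists_coatom {C : Type} [HeytingAlgebra C] (hC : OneGenerated C) {n : ℕ}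
    (hn : 1 ≤ n) (hcard : Nat.card C = 2 * n + 1) :
    ∃ m : C, m ≠ ⊤ ∧ ∀ c : C, c ≠ ⊤ → c ≤ m := by
  have : Finite C := Nat.finite_of_card_ne_zero (by omega)
  obtain ⟨g, hg⟩ := hC
  have hf := Ladder.lift_surjective hg
  obtain ⟨a, ha, h⟩ := Ladder.exists_least_ker (Ladder.lift g)
  have hcard' := Ladder.natCard_of_least_ker hf ha
  rcases h with ⟨k, rfl⟩ | ⟨k, rfl⟩
  · exfalso
    cases k with
    | zero => simp at hcard'; omega
    | succ k => rw [(Ladder.ncard_Iic_rnO k).2] at hcard'; omega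
  · cases k with
    | zero =>
      have h1 := (Ladder.ncard_Iic_rnO 0).2
      simp only [zero_add, rnO_succ, rnO_zero, rnE_zero, bot_sup_eq] at h1
      rw [rnE_zero, h1] at hcard'
      omega
    | succ k =>
      refine ⟨Ladder.lift g (rnO Ladder.gen k), fun h => ?_, fun c hc => ?_⟩
      · exact Ladder.not_rnE_le_rnO_of_le (by omega) ((ha _).1 h)
      · obtain ⟨z, rfl⟩ := hf c
        have hz : ¬ rnE Ladder.gen (k + 1) ≤ z := fun h => hc ((ha z).2 h)
        have h1 : z ⊓ rnE Ladder.gen (k + 1) ∈ Set.Iic (rnE Ladder.gen (k + 1)) :=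
          Set.mem_Iic.2 inf_le_right
        rw [Ladder.Iic_rnE_succ] at h1
        have h2 : z ⊓ rnE Ladder.gen (k + 1) ≤ rnO Ladder.gen k :=
          h1.resolve_left fun h => hz (inf_eq_right.1 h)
        simpa [(ha _).2 le_rfl] using OrderHomClass.mono (Ladder.lift g) h2

theorem exists_oneGenerated_card (n : ℕ) (hn : 1 ≤ n) :
    ∃ C : HeytAlg.{0}, OneGenerated C ∧ Nat.card C = 2 * n + 1 := by
  obtain ⟨k, rfl⟩ : ∃ k, n = k + 1 := ⟨n - 1, by omega⟩
  refine ⟨HeytAlg.of (Below (rnE Ladder.gen (k + 2))), ⟨_, Ladder.generates_map _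
    (Below.proj_surjective _)⟩, ?_⟩
  exact Ladder.ncard_Iic_rnE k

/-! ### Validity and membership in the generated variety. -/

/-- A valuation in variables from `Fin n`, extended to countably many variables. -/
theorem exists_extend_valuation {n : ℕ} {H : Type*} [HeytingAlgebra H] (v : Fin n → H) :
    ∃ w : ℕ → H, ∀ i : Fin n, w i = v i :=
  ⟨fun k => if h : k < n then v ⟨k, h⟩ else ⊥, fun i => by simp⟩

/-- Renaming of variables in a formula. -/
def PropFormula.rename {α β : Type} (r : α → β) : PropFormula α → PropFormula β
  | .var p => .var (r p)
  | .and A B => .and (A.rename r) (B.rename r)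
  | .or A B => .or (A.rename r) (B.rename r)
  | .imp A B => .imp (A.rename r) (B.rename r)
  | .neg A => .neg (A.rename r)

theorem PropFormula.eval_rename {α β : Type} {H : Type*} [HeytingAlgebra H] (r : α → β)
    (v : β → H) (A : PropFormula α) : (A.rename r).eval v = A.eval (fun i => v (r i)) := by
  induction A <;> simp_all [PropFormula.rename, PropFormula.eval]

theorem validIn_generatedVariety {W : HeytAlg.{u}} {n : ℕ} {A : PropFormula (Fin n)}
    (h : ∀ v : Fin n → W, A.eval v = ⊤) : ValidIn (generatedVariety W) A := by
  intro B hB v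
  obtain ⟨w, hw⟩ := exists_extend_valuation v
  have key := hB _ ⟨{(A.rename (fun i : Fin n => (i : ℕ)), .imp (.var 0) (.var 0))}, rfl⟩
    (by
      rintro e rfl w
      simp [PropFormula.eval_rename, h, PropFormula.eval]) _ rfl w
  simpa [PropFormula.eval_rename, hw, PropFormula.eval] using key

theorem mem_generatedVariety_of_surjective {W B : HeytAlg.{u}} (f : HeytingHom W B)
    (hf : Function.Surjective f) : B ∈ generatedVariety W := by
  rintro K ⟨E, rfl⟩ hW e he v
  choose s hs using hf
  have h1 := congrArg f (hW e he fun i => s (v i))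
  rw [map_eval, map_eval] at h1
  simpa [hs] using h1

/-! ### Recovering the upper summand from the order. -/

/-- The lower summand `Z × Z₂`. -/
abbrev LadderBool : Type := Ladder × Bool

section Isomorphism

variable {C D : Type} [HeytingAlgebra C] [HeytingAlgebra D]

/-- In `Z × Z₂` only the bounds are comparable with both `(⊥, true)` and `(⊤, false)`. So the glued
element is the least nonzero element comparable with everything. -/
theorem glue_le {t : Concat LadderBool C} (ht : t ≠ ⊥) (h : ∀ x, x ≤ t ∨ t ≤ x) :
    Concat.inl C ⊤ ≤ t := by
  rcases Concat.le_inl_top_or t with h1 | h1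
  · have hs : t.snd = ⊥ := le_bot_iff.1 h1.2
    refine ⟨?_, bot_le⟩
    have hf : t.fst ≠ ⊥ := fun h => ht (Concat.ext h hs)
    have h2 := h (Concat.inl C (⊥, true))
    have h3 := h (Concat.inl C (⊤, false))
    simp only [Concat.le_def, Concat.fst_inl, Concat.snd_inl, hs, le_refl, and_true] at h2 h3
    obtain ⟨⟨z, e⟩, s, hg⟩ := t
    simp only [Prod.mk_le_mk] at h2 h3 ⊢
    have ht : (⊤ : LadderBool) = (⊤, true) := rfl
    rw [ht, Prod.mk_le_mk]
    cases e with
    | false =>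
      have h4 := h2.resolve_left fun h => absurd h.2 (by decide)
      exact (hf (Prod.ext (le_bot_iff.1 h4.1) rfl)).elim
    | true =>
      have h4 := h3.resolve_right fun h => absurd h.2 (by decide)
      exact ⟨h4.1, le_rfl⟩
  · exact h1

theorem card_eq_of_orderIso (f : Concat LadderBool C ≃o Concat LadderBool D) :
    Nat.card C = Nat.card D := by
  have aux : ∀ {C D : Type} [HeytingAlgebra C] [HeytingAlgebra D]
      (f : Concat LadderBool C ≃o Concat LadderBool D),
      Concat.inl D ⊤ ≤ f (Concat.inl C ⊤) := by
    intro C D _ _ f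
    apply glue_le
    · intro h
      have h1 : Concat.inl C (⊤ : LadderBool) = ⊥ := by simpa using h
      exact (bot_ne_top (α := LadderBool)) (congrArg Concat.fst h1).symm
    · intro x
      obtain ⟨y, rfl⟩ := f.surjective x
      simpa using Concat.le_inl_top_or y
  have hglue : f (Concat.inl C ⊤) = Concat.inl D ⊤ := by
    refine le_antisymm ?_ (aux f)
    have := f.monotone (aux f.symm)
    simpa using this
  have equiv : ∀ (C : Type) [HeytingAlgebra C],
      Nat.card (Set.Ici (Concat.inl C (⊤ : LadderBool))) = Nat.card C := by
    intro C _
    refine (Nat.card_congr (Equiv.ofBijective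
      (fun c : C => ⟨Concat.inr LadderBool c, ⟨le_rfl, bot_le⟩⟩) ⟨?_, ?_⟩)).symm
    · intro c d h
      exact congrArg (fun z => z.1.snd) h
    · rintro ⟨z, hz⟩
      exact ⟨z.snd, Subtype.ext (Concat.eq_inr (top_le_iff.1 hz.1)).symm⟩
  rw [← equiv C, ← equiv D]
  refine Nat.card_congr (f.toEquiv.subtypeEquiv fun z => ?_)
  rw [Set.mem_Ici, Set.mem_Ici, ← hglue]
  exact f.le_iff_le.symm

end Isomorphism

/-! ### Infinity, membership and irreducibility of the examples. -/

section Members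

variable {C : Type} [HeytingAlgebra C]

theorem infinite_ladderConcat : Infinite (ladderConcat C) :=
  Infinite.of_injective (fun z : Ladder => Concat.inl C ((z, false) : LadderBool))
    fun _ _ h => congrArg (fun z => z.fst.1) h

theorem ladderConcat_mem (hC : OneGenerated C) :
    ladderConcat C ∈ generatedVariety (ladderConcat Ladder) := by
  obtain ⟨g, hg⟩ := hC
  exact mem_generatedVariety_of_surjective (W := ladderConcat Ladder) (B := ladderConcat C)
    (Concat.mapHom LadderBool (Ladder.lift g))
    (Concat.mapHom_surjective _ (Ladder.lift_surjective hg))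

theorem subdirectlyIrreducible_concat {A : Type} [HeytingAlgebra A] {m : C} (hm : m ≠ ⊤)
    (h : ∀ c : C, c ≠ ⊤ → c ≤ m) : SubdirectlyIrreducible (Concat A C) := by
  refine subdirectlyIrreducible_of_forall_le (m := Concat.inr A m)
    (fun h => hm (congrArg Concat.snd h)) fun x hx => ?_
  rcases x.glue with h1 | h1
  · exact ⟨le_top, h _ fun h2 => hx (Concat.ext h1 h2)⟩
  · exact ⟨le_top, h1 ▸ bot_le⟩

end Members

/-! ### Relations presenting the lower summand. -/

/-- The relations on two elements `c` and `x` that present the summand `Z × Z₂`, where `c` stands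
for `(0, 1)` and `x` for `(g, 0)`. -/
structure LadderRelations {H : Type*} [HeytingAlgebra H] (c x : H) : Prop where
  regular : cᶜᶜ ≤ c
  le_compl : x ≤ cᶜ
  himp_le : xᶜᶜ ⇨ x ≤ c ⊔ cᶜ
  himp_le_self : (c ⊔ cᶜ) ⇨ (xᶜ ⊔ xᶜᶜ) ≤ xᶜ ⊔ xᶜᶜ

/-- In a one-generated algebra the relations force `c` to be complemented. -/
theorem LadderRelations.sup_compl_eq_top {H : Type*} [HeytingAlgebra H] {g c x : H}
    (hg : Generates ({g} : Set H)) (h : LadderRelations c x) : c ⊔ cᶜ = ⊤ := by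
  have hreg : xᶜᶜ ≤ x → c ⊔ cᶜ = ⊤ := fun hx =>
    top_le_iff.1 ((himp_eq_top_iff.2 hx).ge.trans h.himp_le)
  rcases hg.cases_regular (h.regular.antisymm le_compl_compl) with rfl | rfl | rfl | rfl
  · simp
  · simp
  · rcases hg.cases_bottom x with rfl | rfl | rfl | rfl | hx
    · exact hreg (by simp)
    -- Here `c = xᶜ`, so the premise and the conclusion of the fourth relation are both `c ⊔ cᶜ`.
    · simpa using h.himp_le_self
    · exact hreg (by simp)
    · exact hreg (by simp)
    · have h1 : gᶜ ≤ gᶜᶜ := (le_sup_right.trans hx).trans h.le_compl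
      have h2 : gᶜ = ⊥ := by simpa using le_inf le_rfl h1
      simp [h2]
  · have h1 : x ≤ gᶜ := by simpa using h.le_compl
    rcases hg.cases_bottom x with rfl | rfl | rfl | rfl | hx
    · exact hreg (by simp)
    · have h2 : x = ⊥ := by simpa using le_inf le_rfl h1
      exact hreg (by simp [h2])
    · exact hreg (by simp)
    · exact hreg (by simp)
    · have h2 : x = gᶜ := h1.antisymm (le_sup_right.trans hx)
      exact hreg (by simp [h2])

namespace Ladder

theorem not_compl_compl_gen_le : ¬ genᶜᶜ ≤ gen := by
  have h := not_rnE_le_rnO_of_le (m := 2) (n := 1) (by omega)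
  rw [← rnE_himp_rnO_pred gen 0] at h
  simpa [rnE_succ, rnO_succ] using h

theorem compl_sup_compl_compl_gen_ne_top : genᶜ ⊔ genᶜᶜ ≠ ⊤ := by
  have h := rnO_ne_top 3
  rw [← rnE_sup_rnE_succ, ← rnE_himp_rnO_pred gen 0] at h
  simpa [rnE_succ, rnO_succ] using h

end Ladder

open Ladder

/-! ### The intended solution and its uniqueness. -/

section Standard

variable (D : Type) [HeytingAlgebra D]

/-- The element `(0, 1)` of the lower summand. -/
noncomputable def stdC : Concat LadderBool D := Concat.inl D (⊥, true)

/-- The element `(g, 0)` of the lower summand. -/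
noncomputable def stdX : Concat LadderBool D := Concat.inl D (gen, false)

/-- The generators of the concatenation, given a generator of the upper summand. -/
noncomputable def stdVal {D : Type} [HeytingAlgebra D] (y : D) : Fin 3 → Concat LadderBool D :=
  ![stdC D, stdX D, Concat.inr LadderBool y]

theorem lb_top : (⊤ : LadderBool) = (⊤, true) := rfl
theorem lb_bot : (⊥ : LadderBool) = (⊥, false) := rfl
theorem lb_compl (z : Ladder) (e : Bool) : ((z, e) : LadderBool)ᶜ = (zᶜ, !e) := rfl

theorem compl_stdC : (stdC D)ᶜ = Concat.inl D (⊤, false) := by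
  ext <;> simp [stdC, lb_compl, lb_bot]

theorem sup_compl_stdC : stdC D ⊔ (stdC D)ᶜ = Concat.inl D ⊤ := by
  rw [compl_stdC]
  ext <;> simp [stdC, lb_top]

theorem compl_inl {a : LadderBool} (ha : a ≠ ⊥) : (Concat.inl D a)ᶜ = Concat.inl D aᶜ := by
  ext : 1 <;> simp [ha]

theorem gen_ne_bot : gen ≠ ⊥ := fun h => not_compl_compl_gen_le (by simp [h])

theorem compl_stdX : (stdX D)ᶜ = Concat.inl D (genᶜ, true) := by
  rw [stdX, compl_inl]
  · rfl
  · simp [lb_bot, gen_ne_bot]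

theorem compl_compl_stdX : (stdX D)ᶜᶜ = Concat.inl D (genᶜᶜ, false) := by
  rw [compl_stdX, compl_inl]
  · rfl
  · simp [lb_bot]

theorem ladderRelations_std : LadderRelations (stdC D) (stdX D) where
  regular := by
    rw [compl_stdC, compl_inl D (by simp [lb_bot])]
    simp [stdC, lb_compl]
  le_compl := by
    rw [compl_stdC]
    exact ⟨⟨le_top, le_rfl⟩, le_rfl⟩
  himp_le := by
    rw [sup_compl_stdC, compl_compl_stdX]
    refine ⟨le_top, ?_⟩
    simp [stdX, Prod.mk_le_mk, not_compl_compl_gen_le]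
  himp_le_self := by
    rw [sup_compl_stdC, compl_compl_stdX, compl_stdX]
    refine ⟨by simp, ?_⟩
    simp [lb_top, compl_sup_compl_compl_gen_ne_top]

variable {D}

/-- If `c` is not complemented, both elements lie in the lower summand and their ladder coordinates
again satisfy the relations. The one-generated case then makes the ladder coordinate of `c`
complemented, hence `⊥` or `⊤`, and non-regularity of `x` does the rest. -/
theorem ladderRelations_concat_cases [Nontrivial D] {c x : Concat LadderBool D}
    (h : LadderRelations c x) : c ⊔ cᶜ = ⊤ ∨ (c = stdC D ∧ x = stdX D) := by
  refine or_iff_not_imp_left.2 fun hd => ?_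
  have hreg : ¬ xᶜᶜ ≤ x := fun hx =>
    hd (top_le_iff.1 ((himp_eq_top_iff.2 hx).ge.trans h.himp_le))
  have hcb : c ≠ ⊥ := by rintro rfl; simp at hd
  have hct : c.fst ≠ ⊤ := by
    intro hc
    have h1 : cᶜ = ⊥ := by ext : 1 <;> simp [hc]
    have h2 := h.regular
    rw [h1, compl_bot, top_le_iff] at h2
    simp [h2] at hd
  have hcs : c.snd = ⊥ := c.glue.resolve_left hct
  have hcf : c.fst ≠ ⊥ := fun hc => hcb (Concat.ext hc hcs)
  obtain ⟨a, rfl⟩ : ∃ a, c = Concat.inl D a := ⟨_, Concat.eq_inl hcs⟩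
  rw [Concat.fst_inl] at hct hcf
  have hcc := compl_inl D hcf
  have hxs : x.snd = ⊥ := le_bot_iff.1 (by simpa [hcc] using h.le_compl.2)
  obtain ⟨b, rfl⟩ : ∃ b, x = Concat.inl D b := ⟨_, Concat.eq_inl hxs⟩
  have hba : b ≤ aᶜ := by simpa [hcc] using h.le_compl.1
  obtain ⟨a, e⟩ := a
  obtain ⟨b, e'⟩ := b
  have hxb : ((b, e') : LadderBool) ≠ ⊥ := by
    intro hb
    refine hreg ?_
    have : Concat.inl D ((b, e') : LadderBool) = ⊥ := Concat.ext hb rfl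
    simp [this]
  have hbreg : ¬ bᶜᶜ ≤ b := by
    intro hb
    refine hreg ⟨⟨?_, ?_⟩, ?_⟩
    · simpa [lb_compl] using hb
    · simp [lb_compl]
    · rw [compl_inl D hxb]
      -- Needed so that the double complement of `x` stays in the lower summand; otherwise `x ≤ cᶜ`
      -- would give `c = ⊥`.
      have : ((b, e') : LadderBool)ᶜ ≠ ⊥ := by
        intro h0
        have h1 : aᶜᶜ = ⊥ := by
          have h2 : bᶜ = ⊥ := congrArg Prod.fst h0
          exact le_bot_iff.1 (h2 ▸ compl_anti hba.1)
        have h3 : eᶜᶜ = ⊥ := by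
          have h2 : e'ᶜ = ⊥ := congrArg Prod.snd h0
          exact le_bot_iff.1 (h2 ▸ compl_anti hba.2)
        exact hcf (Prod.ext (le_bot_iff.1 (le_compl_compl.trans h1.le)) (by simpa using h3))
      rw [compl_inl D this]
      exact le_rfl
  have hareg : aᶜᶜ = a := by
    refine le_antisymm ?_ le_compl_compl
    have h1 := h.regular.1.1
    rw [hcc] at h1
    simpa [lb_compl] using h1
  have hrel : LadderRelations a b := by
    have h3 := h.himp_le.1.1
    have h4 := h.himp_le_self.1.1
    refine ⟨hareg.le, hba.1, ?_, ?_⟩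
    · simpa [lb_compl] using h3
    · simpa [lb_compl] using h4
  have hab := hrel.sup_compl_eq_top generates_gen
  rcases generates_gen.cases_regular hareg with rfl | rfl | rfl | rfl
  · cases e with
    | false => exact absurd rfl hcf
    | true =>
      have he' : e' = false := by
        have h1 : e' ≤ false := hba.2
        cases e' with
        | false => rfl
        | true => exact absurd h1 (by decide)
      subst he'
      refine ⟨rfl, ?_⟩
      rcases generates_gen.cases_bottom b with rfl | rfl | rfl | rfl | hb
      · exact absurd (by simp) hbreg
      · rfl
      · exact absurd (by simp) hbreg
      · exact absurd (by simp) hbreg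
      · exfalso
        have hb0 : bᶜ = ⊥ := by
          refine le_bot_iff.1 ((compl_anti hb).trans ?_)
          simp [compl_sup]
        -- For dense `b`, `xᶜ ⊔ xᶜᶜ` is the glued element, so the fourth relation would put `⊤`
        -- below it, against nontriviality of `D`.
        have h4 := h.himp_le_self.2
        rw [hcc, compl_inl D hxb, compl_inl D (by simp [lb_compl, lb_bot])] at h4
        simp [lb_compl, hb0] at h4
  · exfalso
    have hb : b = ⊥ := by simpa using hba.1
    exact hbreg (by simp [hb])
  · exact absurd hab compl_sup_compl_compl_gen_ne_top
  · refine absurd ?_ compl_sup_compl_compl_gen_ne_top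
    rw [sup_comm]
    simpa using hab

theorem generates_stdVal {y : D} (hy : Generates ({y} : Set D)) :
    Generates (Set.range (stdVal y)) := by
  intro S hS hG
  have hc : stdC D ∈ S := hG ⟨0, rfl⟩
  have hx : stdX D ∈ S := hG ⟨1, rfl⟩
  have hy' : Concat.inr LadderBool y ∈ S := hG ⟨2, rfl⟩
  have hc' : Concat.inl D (⊤, false) ∈ S := compl_stdC D ▸ hS.compl_mem _ hc
  have hd : Concat.inl D ⊤ ∈ S :=
    sup_compl_stdC D ▸ hS.sup_mem _ hc _ (hS.compl_mem _ hc)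
  have hbot : Concat.inl D (⊥, false) ∈ S := by
    have : Concat.inl D ((⊥, false) : LadderBool) = stdC D ⊓ (stdC D)ᶜ := by
      rw [inf_compl_self]
      rfl
    exact this ▸ hS.inf_mem _ hc _ (hS.compl_mem _ hc)
  have hlow : ∀ z : Ladder, Concat.inl D ((z, false) : LadderBool) ∈ S := by
    have hsub : IsSubalgebra {z : Ladder | Concat.inl D ((z, false) : LadderBool) ∈ S} := by
      have himp : ∀ z w : Ladder, Concat.inl D ((z, false) : LadderBool) ∈ S →
          Concat.inl D ((w, false) : LadderBool) ∈ S →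
          Concat.inl D ((z ⇨ w, false) : LadderBool) ∈ S := by
        intro z w hz hw
        -- The implication has Boolean coordinate `true`; meeting with `cᶜ` resets it and returns to
        -- the lower summand.
        have : Concat.inl D ((z ⇨ w, false) : LadderBool) =
            (Concat.inl D (z, false) ⇨ Concat.inl D (w, false)) ⊓ Concat.inl D (⊤, false) := by
          refine Concat.ext (Prod.ext ?_ ?_) ?_ <;> simp
        exact this ▸ hS.inf_mem _ (hS.himp_mem _ hz _ hw) _ hc'
      refine ⟨fun z hz w hw => ?_, fun z hz w hw => ?_,
        fun z hz w hw => himp z w hz hw, fun z hz => ?_⟩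
      · have : Concat.inl D ((z ⊓ w, false) : LadderBool) =
            Concat.inl D (z, false) ⊓ Concat.inl D (w, false) := by
          refine Concat.ext (Prod.ext ?_ ?_) ?_ <;> simp
        exact (this ▸ hS.inf_mem _ hz _ hw :)
      · have : Concat.inl D ((z ⊔ w, false) : LadderBool) =
            Concat.inl D (z, false) ⊔ Concat.inl D (w, false) := by
          refine Concat.ext (Prod.ext ?_ ?_) ?_ <;> simp
        exact (this ▸ hS.sup_mem _ hz _ hw :)
      · have := himp z ⊥ hz hbot
        rwa [himp_bot] at this
    exact Set.eq_univ_iff_forall.1 (generates_gen _ hsub (Set.singleton_subset_iff.2 hx))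
  have hup : ∀ b : D, Concat.inr LadderBool b ∈ S := by
    have hsub : IsSubalgebra {b : D | Concat.inr LadderBool b ∈ S} := by
      refine ⟨fun z hz w hw => ?_, fun z hz w hw => ?_, fun z hz w hw => ?_, fun z hz => ?_⟩
      · have : Concat.inr LadderBool (z ⊓ w) =
            Concat.inr LadderBool z ⊓ Concat.inr LadderBool w := by
          ext : 1 <;> simp
        exact (this ▸ hS.inf_mem _ hz _ hw :)
      · have : Concat.inr LadderBool (z ⊔ w) =
            Concat.inr LadderBool z ⊔ Concat.inr LadderBool w := by
          ext : 1 <;> simp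
        exact (this ▸ hS.sup_mem _ hz _ hw :)
      · have : Concat.inr LadderBool (z ⇨ w) =
            Concat.inr LadderBool z ⇨ Concat.inr LadderBool w := by
          ext : 1 <;> simp
        exact (this ▸ hS.himp_mem _ hz _ hw :)
      · have : Concat.inr LadderBool zᶜ =
            Concat.inr LadderBool z ⇨ Concat.inl D ⊤ := by
          ext : 1 <;> simp
        exact (this ▸ hS.himp_mem _ hz _ hd :)
    exact Set.eq_univ_iff_forall.1 (hy _ hsub (Set.singleton_subset_iff.2 hy'))
  refine Set.eq_univ_of_forall fun z => ?_
  rcases z.glue with h | h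
  · exact Concat.eq_inr h ▸ hup _
  · rw [Concat.eq_inl h]
    obtain ⟨a, e⟩ := z.fst
    cases e with
    | false => exact hlow a
    | true =>
      have : Concat.inl D ((a, true) : LadderBool) = Concat.inl D (a, false) ⊔ stdC D := by
        refine Concat.ext (Prod.ext ?_ ?_) ?_ <;> simp [stdC]
      exact this ▸ hS.sup_mem _ (hlow a) _ hc

end Standard

/-! ### The presenting formula and its validity. -/

section Formulas

/-- The formula `p₀ ∨ ¬p₀`, standing for the glued element. -/
def glueFormula : PropFormula (Fin 3) := .or (.var 0) (.neg (.var 0))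

/-- The formula `¬p₁ ∨ ¬¬p₁`. -/
def weakFormula : PropFormula (Fin 3) := .or (.neg (.var 1)) (.neg (.neg (.var 1)))

/-- The formula expressing the relations of the lower summand, and that `p₂` is above the glued
element. -/
def lowerFormula : PropFormula (Fin 3) :=
  .and (.and (.and (.imp (.neg (.neg (.var 0))) (.var 0)) (.imp (.var 1) (.neg (.var 0))))
    (.and (.imp (.imp (.neg (.neg (.var 1))) (.var 1)) glueFormula)
      (.imp (.imp glueFormula weakFormula) weakFormula)))
    (.imp glueFormula (.var 2))

/-- The translation of a formula in one variable, with the glued element in the role of `⊥`. -/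
def upperFormula : PropFormula Unit → PropFormula (Fin 3)
  | .var _ => .var 2
  | .and A B => .and (upperFormula A) (upperFormula B)
  | .or A B => .or (upperFormula A) (upperFormula B)
  | .imp A B => .imp (upperFormula A) (upperFormula B)
  | .neg A => .imp (upperFormula A) glueFormula

theorem eval_lowerFormula {H : Type*} [HeytingAlgebra H] {v : Fin 3 → H} :
    lowerFormula.eval v = ⊤ ↔ LadderRelations (v 0) (v 1) ∧ v 0 ⊔ (v 0)ᶜ ≤ v 2 := by
  simp only [lowerFormula, glueFormula, weakFormula, PropFormula.eval, inf_eq_top_iff,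
    himp_eq_top_iff]
  exact ⟨fun ⟨⟨⟨h1, h2⟩, h3, h4⟩, h5⟩ => ⟨⟨h1, h2, h3, h4⟩, h5⟩,
    fun ⟨⟨h1, h2, h3, h4⟩, h5⟩ => ⟨⟨⟨h1, h2⟩, h3, h4⟩, h5⟩⟩

variable {D : Type} [HeytingAlgebra D]

theorem eval_upperFormula (y : D) (F : PropFormula Unit) :
    (upperFormula F).eval (stdVal y) = Concat.inr LadderBool (F.eval fun _ => y) := by
  induction F with
  | var p => rfl
  | and A B hA hB =>
    simp only [upperFormula, PropFormula.eval, hA, hB]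
    ext : 1 <;> simp
  | or A B hA hB =>
    simp only [upperFormula, PropFormula.eval, hA, hB]
    ext : 1 <;> simp
  | imp A B hA hB =>
    simp only [upperFormula, PropFormula.eval, hA, hB]
    ext : 1 <;> simp
  | neg A hA =>
    have hg : glueFormula.eval (stdVal y) = Concat.inl D ⊤ := sup_compl_stdC D
    simp only [upperFormula, PropFormula.eval, hA, hg]
    ext : 1 <;> simp

theorem eval_lowerFormula_stdVal (y : D) : lowerFormula.eval (stdVal y) = ⊤ := by
  refine eval_lowerFormula.2 ⟨ladderRelations_std D, ?_⟩
  change stdC D ⊔ (stdC D)ᶜ ≤ Concat.inr LadderBool y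
  rw [sup_compl_stdC]
  exact ⟨le_rfl, bot_le⟩

/-- If the first element is complemented and the third one is `⊤`, then validity in the lower
summand suffices. -/
theorem eval_eq_top_of_complemented {y : D} {B : PropFormula (Fin 3)}
    (hB : B.eval (stdVal y) = ⊤) {H : Type} [HeytingAlgebra H] {v : Fin 3 → H}
    (hd : v 0 ⊔ (v 0)ᶜ = ⊤) (hx : v 1 ≤ (v 0)ᶜ) (hy : v 0 ⊔ (v 0)ᶜ ≤ v 2) :
    B.eval v = ⊤ := by
  have hy' : v 2 = ⊤ := top_le_iff.1 (hd ▸ hy)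
  -- Below `c` the valuation becomes `(⊤, ⊥, ⊤)`, the image of the standard one through `Z₂`; below
  -- `cᶜ` it becomes `(⊥, x, ⊤)`, an image through `Z`.
  have h1 : v 0 ≤ B.eval v := by
    have h := congrArg (boolHom (Below (v 0)))
      (congrArg (sndHom Ladder Bool) (congrArg (Concat.fstHom LadderBool D) hB))
    simp only [map_eval, map_top] at h
    rw [← Below.proj_eq_top, map_eval, ← h]
    congr 1
    funext i
    fin_cases i
    · exact Below.proj_eq_top.2 le_rfl
    · exact Below.proj_eq_bot.2 (disjoint_iff.1 (le_compl_iff_disjoint_right.1 hx))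
    · exact Below.proj_eq_top.2 (hy' ▸ le_top)
  have h2 : (v 0)ᶜ ≤ B.eval v := by
    have h := congrArg (lift (Below.proj (v 0)ᶜ (v 1)))
      (congrArg (fstHom Ladder Bool) (congrArg (Concat.fstHom LadderBool D) hB))
    simp only [map_eval, map_top] at h
    rw [← Below.proj_eq_top, map_eval, ← h]
    congr 1
    funext i
    fin_cases i
    · refine (Below.proj_eq_bot.2 (inf_compl_self _)).trans ?_
      exact (map_bot (lift (Below.proj (v 0)ᶜ (v 1)))).symm
    · rfl
    · refine (Below.proj_eq_top.2 (hy' ▸ le_top)).trans ?_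
      exact (map_top (lift (Below.proj (v 0)ᶜ (v 1)))).symm
  exact top_le_iff.1 (hd ▸ sup_le h1 h2)

variable {C : Type} [HeytingAlgebra C]

theorem mapHom_stdVal (f : HeytingHom C D) (y : C) :
    (fun i => Concat.mapHom LadderBool f (stdVal y i)) = stdVal (f y) := by
  funext i
  fin_cases i
  · exact Concat.ext rfl (map_bot f)
  · exact Concat.ext rfl (map_bot f)
  · rfl

/-- Evaluate `B` in `Z × Z₂ + Z`: truth over `C` puts its upper coordinate above the kernel
generator `F`, and the map sending the generator to `y` kills `F`. -/
theorem eval_stdVal_eq_top {g : C} {F : PropFormula Unit}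
    (hF : ∀ z, lift g z = ⊤ ↔ Ladder.mk F ≤ z) {B : PropFormula (Fin 3)}
    (hB : B.eval (stdVal g) = ⊤) {y : D} (hy : (F.eval fun _ => y) = ⊤) :
    B.eval (stdVal y) = ⊤ := by
  have h1 := map_eval (Concat.mapHom LadderBool (lift g)) (stdVal gen) B
  have h2 := map_eval (Concat.mapHom LadderBool (lift y)) (stdVal gen) B
  rw [mapHom_stdVal, lift_gen] at h1 h2
  rw [hB] at h1
  rw [← h2]
  have h3 := (hF _).1 (congrArg Concat.snd h1)
  have h5 : (B.eval (stdVal gen)).fst = ⊤ := congrArg Concat.fst h1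
  refine Concat.ext h5 (top_le_iff.1 ?_)
  have h4 := OrderHomClass.mono (lift y) h3
  rwa [lift_mk, hy] at h4

theorem eval_le_eval {g : C} {F : PropFormula Unit}
    (hF : ∀ z, lift g z = ⊤ ↔ Ladder.mk F ≤ z) {B : PropFormula (Fin 3)}
    (hB : B.eval (stdVal g) = ⊤) (v : Fin 3 → Concat LadderBool D) :
    (PropFormula.and lowerFormula (upperFormula F)).eval v ≤ B.eval v := by
  generalize hq : (PropFormula.and lowerFormula (upperFormula F)).eval v = q
  have upper : ∀ {H : Type} [HeytingAlgebra H] (f : HeytingHom (Concat LadderBool D) H),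
      f q = ⊤ → (upperFormula F).eval (fun i => f (v i)) = ⊤ := by
    intro H _ f hf
    rw [← hq, map_eval] at hf
    exact (inf_eq_top_iff.1 hf).2
  have lower : ∀ {H : Type} [HeytingAlgebra H] (f : HeytingHom (Concat LadderBool D) H),
      f q = ⊤ → LadderRelations (f (v 0)) (f (v 1)) ∧ f (v 0) ⊔ (f (v 0))ᶜ ≤ f (v 2) := by
    intro H _ f hf
    rw [← hq, map_eval] at hf
    exact eval_lowerFormula.1 (inf_eq_top_iff.1 hf).1
  -- If `q` is in the lower summand, the two coordinates are compared separately. Otherwise the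
  -- quotient by `q` keeps all of `Z × Z₂` and a nontrivial top part.
  by_cases hs : q.snd = ⊥
  · refine ⟨⟨?_, ?_⟩, hs ▸ bot_le⟩
    · let p := (fstHom Ladder Bool).comp (Concat.fstHom LadderBool D)
      let f := (Below.proj (p q)).comp p
      have hf : f q = ⊤ := Below.proj_eq_top.2 le_rfl
      obtain ⟨h1, h2⟩ := lower f hf
      have h3 := h1.sup_compl_eq_top
        (Ladder.generates_map _ (Below.proj_surjective (p q)))
      have h4 := eval_eq_top_of_complemented hB (v := fun i => f (v i)) h3 h1.le_compl h2
      rw [← map_eval] at h4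
      exact Below.proj_eq_top.1 h4
    · let f := (sndHom Ladder Bool).comp (Concat.fstHom LadderBool D)
      change f q ≤ f (B.eval v)
      by_cases hf : f q = ⊤
      · obtain ⟨h1, h2⟩ := lower f hf
        have h4 := eval_eq_top_of_complemented hB (v := fun i => f (v i)) sup_compl_eq_top
          h1.le_compl h2
        rw [← map_eval] at h4
        exact h4 ▸ le_top
      · have : f q = ⊥ := by
          revert hf
          cases f q <;> simp
        exact this ▸ bot_le
  · have hfst : q.fst = ⊤ := q.glue.resolve_right hs
    let f := Concat.mapHom LadderBool (Below.proj q.snd)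
    have hf : f q = ⊤ := Concat.ext hfst (Below.proj_eq_top.2 le_rfl)
    suffices h : f (B.eval v) = ⊤ from
      ⟨(congrArg Concat.fst h).ge.trans' le_top, Below.proj_eq_top.1 (congrArg Concat.snd h)⟩
    have : Nontrivial (Below q.snd) := ⟨⊤, ⊥, fun h => hs (congrArg Subtype.val h)⟩
    obtain ⟨h1, h2⟩ := lower f hf
    rw [map_eval]
    rcases ladderRelations_concat_cases h1 with h3 | ⟨hc, hx⟩
    · exact eval_eq_top_of_complemented hB h3 h1.le_compl h2
    · have hy : f (v 2) = Concat.inr LadderBool (f (v 2)).snd := by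
        refine Concat.eq_inr (top_le_iff.1 ?_)
        rw [hc, sup_compl_stdC] at h2
        exact h2.1
      have hv : (fun i => f (v i)) = stdVal (f (v 2)).snd := by
        funext i
        fin_cases i
        · exact hc
        · exact hx
        · exact hy
      rw [hv]
      refine eval_stdVal_eq_top hF hB ?_
      have := upper f hf
      rw [hv, eval_upperFormula] at this
      exact congrArg Concat.snd this

theorem finitelyPresentableOver_ladderConcat [Finite C] (hC : OneGenerated C) :
    FinitelyPresentableOver (generatedVariety (ladderConcat Ladder)) (ladderConcat C) := by
  obtain ⟨g, hg⟩ := hC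
  obtain ⟨a, ha, -⟩ := exists_least_ker (lift g)
  obtain ⟨F, rfl⟩ : ∃ F, Ladder.mk F = a := Quotient.exists_rep a
  refine ⟨3, .and lowerFormula (upperFormula F), stdVal g, generates_stdVal hg, ?_, ?_⟩
  · have hFg : (F.eval fun _ => g) = ⊤ := (ha (Ladder.mk F)).2 le_rfl
    refine inf_eq_top_iff.2 ⟨eval_lowerFormula_stdVal g, ?_⟩
    refine (eval_upperFormula g F).trans ?_
    rw [hFg]
    rfl
  · intro B hB
    exact validIn_generatedVariety (W := ladderConcat Ladder) fun v =>
      himp_eq_top_iff.2 (eval_le_eval (D := Ladder) ha hB v)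

theorem ladderConcat_mem_FPSI (hC : OneGenerated C) {n : ℕ} (hn : 1 ≤ n)
    (hcard : Nat.card C = 2 * n + 1) :
    ladderConcat C ∈ FPSI (generatedVariety (ladderConcat Ladder)) := by
  have : Finite C := Nat.finite_of_card_ne_zero (by omega)
  obtain ⟨m, hm, hle⟩ := hC.exists_coatom hn hcard
  exact ⟨ladderConcat_mem hC, subdirectlyIrreducible_concat hm hle,
    finitelyPresentableOver_ladderConcat hC⟩

end Formulas

end HeytingVarieties

open HeytingVarieties
/-- Let `V` be the variety generated by `Z × Z₂ + Z`. There are infinitely many pairwise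
non-isomorphic infinite algebras in `FPSI(V)`. For `n ≥ 1` the `(2n+1)`-element one-generated
algebra exists, and for every such algebra `C` the algebra `Z × Z₂ + C` is infinite and belongs to
`FPSI(V)`; different `n` give non-isomorphic algebras. -/
theorem corollary5p3 :
    (∃ F : ℕ → HeytAlg.{0},
      (∀ i, F i ∈ FPSI (generatedVariety (ladderConcat Ladder)) ∧ Infinite (F i)) ∧
      Pairwise fun i j => IsEmpty (F i ≃o F j)) ∧
    (∀ n : ℕ, 1 ≤ n → ∃ C : HeytAlg.{0},
      OneGenerated C ∧ Nat.card C = 2 * n + 1) ∧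
    (∀ n : ℕ, 1 ≤ n → ∀ (C : Type) [HeytingAlgebra C],
      OneGenerated C → Nat.card C = 2 * n + 1 →
        ladderConcat C ∈ FPSI (generatedVariety (ladderConcat Ladder)) ∧
        Infinite (ladderConcat C)) ∧
    (∀ m n : ℕ, 1 ≤ m → 1 ≤ n → m ≠ n →
      ∀ (C D : Type) [HeytingAlgebra C] [HeytingAlgebra D],
        OneGenerated C → Nat.card C = 2 * m + 1 →
        OneGenerated D → Nat.card D = 2 * n + 1 →
        IsEmpty (ladderConcat C ≃o ladderConcat D)) := by
  have hiso : ∀ m n : ℕ, m ≠ n → ∀ (C D : Type) [HeytingAlgebra C] [HeytingAlgebra D],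
      Nat.card C = 2 * m + 1 → Nat.card D = 2 * n + 1 →
        IsEmpty (ladderConcat C ≃o ladderConcat D) := by
    intro m n hmn C D _ _ hC hD
    refine ⟨fun f => hmn ?_⟩
    have := card_eq_of_orderIso (C := C) (D := D) f
    omega
  refine ⟨?_, exists_oneGenerated_card,
    fun n hn C _ hC hcard => ⟨ladderConcat_mem_FPSI hC hn hcard, infinite_ladderConcat⟩,
    fun m n _ _ hmn C D _ _ _ hC _ hD => hiso m n hmn C D hC hD⟩
  choose C hgen hcard using fun i : ℕ => exists_oneGenerated_card (i + 1) (Nat.le_add_left 1 i)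
  exact ⟨fun i => ladderConcat (C i), fun i =>
    ⟨ladderConcat_mem_FPSI (hgen i) (Nat.le_add_left 1 i) (hcard i), infinite_ladderConcat⟩,
    fun i j hij => hiso (i + 1) (j + 1) (by omega) (C i) (C j) (hcard i) (hcard j)⟩
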